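/- Let $0<m_0\le\beta<\infty$. For $b>0$ let $\mathcal P([0,b])$ be the set of Borel probability distributions on $[0,b]$, with the $1$-Wasserstein metric $d_W(\xi_1,\xi_2)=\int_0^b|F_{\xi_1}(t)-F_{\xi_2}(t)|\,dt$, where $F_\xi$ is the distribution function of $\xi$. Let $\mu,\nu\in\mathcal P([0,\beta])$ satisfy $\int_0^\beta k\,\mu(dk)=\int_0^\beta k\,\nu(dk)\ge m_0$, and let $q_\mu,q_\nu$ be their quantile functions. Let $\mathbb S=[0,\infty)^2\setminus\{(0,0)\}$, and let $\delta_t$ be the point mass at $t$. Randomly reinforced urn. On a probability space let $(U_n)_{n\ge1}$ be i.i.d. uniform on $[0,1]$ and, independently of $(U_n)$, let $(V_n,W_n)_{n\ge1}$ be i.i.d. random vectors whose components are uniform on $[0,1]$ (with arbitrary dependence between $V_n$ and $W_n$). For $(x,y)\in\mathbb S$ put $X_0=x$, $Y_0=y$ and, for $n\ge0$, $$X_{n+1}=X_n+q_\mu(V_{n+1})\,\mathbb I_{n+1},\qquad Y_{n+1}=Y_n+q_\nu(W_{n+1})(1-\mathbb I_{n+1}),$$ where $\mathbb I_{n+1}$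 is the indicator of $\{U_{n+1}\le X_n/(X_n+Y_n)\}$; let $Z_n(x,y)=X_n/(X_n+Y_n)$. Proposition. For every $(x,y)\in\mathbb S$ the sequence $Z_n(x,y)$ converges almost surely to a random variable $Z_\infty(x,y)\in[0,1]$, whose law $\mathcal F_{(\mu,\nu)}(x,y)$ depends neither on the probability space nor on the choice of the sequences $(U_n)$, $(V_n,W_n)$. The map $\mathcal F=\mathcal F_{(\mu,\nu)}:\mathbb S\to\mathcal P([0,1])$ satisfies: 1. $\mathcal F$ is continuous from $\mathbb S$ to $(\mathcal P([0,1]),d_W)$; 2. for all $(x,y)\in\mathbb S$, $$x\int_0^\beta\big(\mathcal F(x,y)-\mathcal F(x+k,y)\big)\mu(dk)+y\int_0^\beta\big(\mathcal F(x,y)-\mathcal F(x,y+k)\big)\nu(dk)=0,$$ as an identity of signed measures, that is, after evaluation at every Borel set $B\subseteq[0,1]$; 3. $\mathcal F(0,y)=\delta_0$ for all $y>0$ and $\mathcal F(x,0)=\delta_1$ for all $x>0$; 4. $d_W\big(\mathcal F(x,y),\delta_{x/(x+y)}\big)\to0$ as $x+y\to\infty$. That is, $\mathcal F_{(\mu,\nu)}$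 solves the functional equation problem whose boundary datum is the continuous map $t\mapsto\delta_t$ from $[0,1]$ to $(\mathcal P([0,1]),d_W)$. Moreover, for all $(x,y)\in\mathbb S$, $$d_W\big(\mathcal F(x,y),\delta_{x/(x+y)}\big)<2\sqrt{\frac{\beta}{x+y}}.$$ -/

import Mathlib

open MeasureTheory ProbabilityTheory Filter Topology Set
open scoped unitInterval

noncomputable section

namespace RRU

/-! ### The Wasserstein distance on probability distributions on `[0, β]` -/

/-- Cumulative distribution function of a probability distribution on `[0, β]`. -/
def distFun {β : ℝ} (ξ : ProbabilityMeasure (Icc (0 : ℝ) β)) (t : ℝ) : ℝ :=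
  (ξ : Measure (Icc (0 : ℝ) β)).real {s | (s : ℝ) ≤ t}

/-- The `1`-Wasserstein distance, as the `L¹` distance of the distribution functions. -/
def dW {β : ℝ} (ξ₁ ξ₂ : ProbabilityMeasure (Icc (0 : ℝ) β)) : ℝ :=
  ∫ t in (0 : ℝ)..β, |distFun ξ₁ t - distFun ξ₂ t|

/-- Continuity of a map into the space of probability distributions on `[0, β]`, where the latter
is metrized by `dW`. -/
def WContinuous {E : Type*} [TopologicalSpace E] {β : ℝ}
    (G : E → ProbabilityMeasure (Icc (0 : ℝ) β)) : Prop :=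
  ∀ a : E, Tendsto (fun b => dW (G b) (G a)) (𝓝 a) (𝓝 0)

/-- The mean of a probability distribution on `[0, β]`. -/
def mean {β : ℝ} (ξ : ProbabilityMeasure (Icc (0 : ℝ) β)) : ℝ :=
  ∫ k, (k : ℝ) ∂(ξ : Measure (Icc (0 : ℝ) β))

/-- The parameters: pairs of distributions on `[0, β]` with equal means, both at least `m₀`. -/
def parameterSet (β m₀ : ℝ) :
    Set (ProbabilityMeasure (Icc (0 : ℝ) β) × ProbabilityMeasure (Icc (0 : ℝ) β)) :=
  {q | mean q.1 = mean q.2 ∧ m₀ ≤ mean q.1}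

/-! ### Boundary data -/

/-- Boundary data: continuous maps from `[0, 1]` to the distributions on `[0, 1]`. -/
structure BoundaryDatum where
  toFun : I → ProbabilityMeasure I
  continuous : WContinuous toFun

/-- Point mass at `t`. -/
def pointMass (t : I) : ProbabilityMeasure I := ⟨Measure.dirac t, inferInstance⟩

lemma distFun_pointMass (t : I) (r : ℝ) :
    distFun (pointMass t) r = if (t : ℝ) ≤ r then 1 else 0 := by
  have hm : MeasurableSet {s : I | (s : ℝ) ≤ r} := measurableSet_le (by fun_prop) (by fun_prop)
  change (Measure.dirac t).real {s : I | (s : ℝ) ≤ r} = _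
  rw [Measure.real, Measure.dirac_apply' _ hm]
  by_cases h : (t : ℝ) ≤ r <;> simp [h]

lemma dW_pointMass_le (s t : I) : dW (pointMass s) (pointMass t) ≤ |(s : ℝ) - t| := by
  have key : ∀ a b : I, (a : ℝ) ≤ b →
      (fun r : ℝ => |distFun (pointMass a) r - distFun (pointMass b) r|)
        = indicator (Ico (a : ℝ) b) 1 := by
    intro a b hab
    funext r
    simp only [distFun_pointMass, indicator, mem_Ico, Pi.one_apply]
    by_cases h1 : (a : ℝ) ≤ r <;> by_cases h2 : (b : ℝ) ≤ r
    · simp [h1, h2, not_lt.mpr h2]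
    · simp [h1, h2, not_le.mp h2]
    · exact absurd (hab.trans h2) h1
    · simp [h1, h2]
  have main : ∀ a b : I, (a : ℝ) ≤ b → dW (pointMass a) (pointMass b) ≤ |(a : ℝ) - b| := by
    intro a b hab
    rw [dW, key a b hab, intervalIntegral.integral_of_le zero_le_one,
      integral_indicator_one measurableSet_Ico, measureReal_restrict_apply measurableSet_Ico]
    calc volume.real (Ico (a : ℝ) b ∩ Ioc 0 1) ≤ volume.real (Ico (a : ℝ) b) :=
          measureReal_mono inter_subset_left (by simp)
      _ = |(a : ℝ) - b| := by
          rw [Real.volume_real_Ico_of_le hab, abs_sub_comm, abs_of_nonneg (by linarith)]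
  rcases le_total (s : ℝ) t with h | h
  · exact main s t h
  · have := main t s h
    rw [abs_sub_comm (s : ℝ) t]
    simpa only [dW, abs_sub_comm] using this

/-- The boundary datum `δ`, with `δ(t)` the point mass at `t`. -/
def deltaDatum : BoundaryDatum where
  toFun := pointMass
  continuous := by
    intro a
    have h0 : Tendsto (fun b : I => |(b : ℝ) - a|) (𝓝 a) (𝓝 0) := by
      have : Continuous (fun b : I => |(b : ℝ) - a|) := by fun_prop
      simpa using this.tendsto a
    refine squeeze_zero (fun b => ?_) (fun b => dW_pointMass_le b a) h0
    exact intervalIntegral.integral_nonneg zero_le_one (fun _ _ => abs_nonneg _)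

/-! ### The state space and the functional equation problem -/

/-- The closed quadrant without the origin. -/
abbrev Quadrant : Type := {p : ℝ × ℝ // 0 ≤ p.1 ∧ 0 ≤ p.2 ∧ p ≠ (0, 0)}

lemma Quadrant.sum_pos (p : Quadrant) : 0 < p.1.1 + p.1.2 := by
  obtain ⟨⟨x, y⟩, hx, hy, hne⟩ := p
  simp only at hx hy ⊢
  rcases hx.lt_or_eq with h | h
  · linarith
  · rcases hy.lt_or_eq with h' | h'
    · linarith
    · exact absurd (by rw [← h, ← h']) hne

lemma Quadrant.mem_of_pos {x y : ℝ} (hx : 0 ≤ x) (hy : 0 ≤ y) (h : 0 < x + y) :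
    0 ≤ (x, y).1 ∧ 0 ≤ (x, y).2 ∧ (x, y) ≠ ((0, 0) : ℝ × ℝ) := by
  refine ⟨hx, hy, fun he => ?_⟩
  rw [Prod.mk.injEq] at he
  linarith [he.1, he.2]

/-- `(x, y) ↦ (x + k, y)` for `k ∈ [0, β]`. -/
def addX {β : ℝ} (p : Quadrant) (k : Icc (0 : ℝ) β) : Quadrant :=
  ⟨(p.1.1 + k, p.1.2), Quadrant.mem_of_pos (add_nonneg p.2.1 k.2.1) p.2.2.1
    (by have := p.sum_pos; have := k.2.1; linarith)⟩

/-- `(x, y) ↦ (x, y + k)` for `k ∈ [0, β]`. -/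
def addY {β : ℝ} (p : Quadrant) (k : Icc (0 : ℝ) β) : Quadrant :=
  ⟨(p.1.1, p.1.2 + k), Quadrant.mem_of_pos p.2.1 (add_nonneg p.2.2.1 k.2.1)
    (by have := p.sum_pos; have := k.2.1; linarith)⟩

/-- The proportion `x / (x + y)`, as an element of `[0, 1]`. -/
def proportion (p : Quadrant) : I :=
  ⟨p.1.1 / (p.1.1 + p.1.2), div_nonneg p.2.1 p.sum_pos.le,
    (div_le_one p.sum_pos).2 (by linarith [p.2.2.1])⟩

/-- `G` solves the functional equation problem with parameters `μ, ν` and boundary datum `φ`.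
The equation between measures is read on every Borel set `B`; the integrands are then bounded, and
they are Borel measurable in `k` since `G` is continuous. -/
structure IsSolution {β : ℝ} (μ ν : ProbabilityMeasure (Icc (0 : ℝ) β)) (φ : BoundaryDatum)
    (G : Quadrant → ProbabilityMeasure I) : Prop where
  continuous : WContinuous G
  equation : ∀ (p : Quadrant) (B : Set I), MeasurableSet B →
    p.1.1 * ∫ k, ((G p : Measure I).real B - (G (addX p k) : Measure I).real B)
        ∂(μ : Measure (Icc (0 : ℝ) β))
      + p.1.2 * ∫ k, ((G p : Measure I).real B - (G (addY p k) : Measure I).real B)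
        ∂(ν : Measure (Icc (0 : ℝ) β)) = 0
  left_boundary : ∀ p : Quadrant, p.1.1 = 0 → G p = φ.toFun 0
  lower_boundary : ∀ p : Quadrant, p.1.2 = 0 → G p = φ.toFun 1
  at_infinity : Tendsto (fun p : Quadrant => dW (G p) (φ.toFun (proportion p)))
    (comap (fun p : Quadrant => p.1.1 + p.1.2) atTop) (𝓝 0)

/-! ### Randomly reinforced urns -/

lemma distFun_self {β : ℝ} (ξ : ProbabilityMeasure (Icc (0 : ℝ) β)) : distFun ξ β = 1 := by
  have : {s : Icc (0 : ℝ) β | (s : ℝ) ≤ β} = univ := eq_univ_of_forall fun s => s.2.2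
  simp [distFun, this]

lemma bound_nonneg {β : ℝ} (ξ : ProbabilityMeasure (Icc (0 : ℝ) β)) : 0 ≤ β := by
  obtain ⟨s⟩ := ξ.nonempty
  exact s.2.1.trans s.2.2

/-- The quantile function `q(t) = inf {z ∈ [0, β] : t ≤ F(z)}`, `t ∈ [0, 1]`. -/
def quantile {β : ℝ} (ξ : ProbabilityMeasure (Icc (0 : ℝ) β)) (t : I) : Icc (0 : ℝ) β :=
  ⟨sInf {z : ℝ | 0 ≤ z ∧ (t : ℝ) ≤ distFun ξ z}, Real.sInf_nonneg fun _ hz => hz.1,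
    csInf_le ⟨0, fun _ hz => hz.1⟩ ⟨bound_nonneg ξ, by rw [distFun_self]; exact t.2.2⟩⟩

lemma quantile_mono {β : ℝ} (ξ : ProbabilityMeasure (Icc (0 : ℝ) β)) : Monotone (quantile ξ) := by
  intro s t hst
  change sInf {z : ℝ | 0 ≤ z ∧ (s : ℝ) ≤ distFun ξ z} ≤ sInf {z : ℝ | 0 ≤ z ∧ (t : ℝ) ≤ distFun ξ z}
  refine csInf_le_csInf ⟨0, fun _ hz => hz.1⟩ ⟨β, bound_nonneg ξ, ?_⟩ fun z hz => ⟨hz.1, ?_⟩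
  · rw [distFun_self]; exact t.2.2
  · exact le_trans (show (s : ℝ) ≤ t from hst) hz.2

section Urn

variable {Ω : Type*} {β : ℝ}

/-- The composition `(Xₙ, Yₙ)` of the urn with initial composition `p` and reinforcement
distributions `μ, ν`, driven by `U`, `V`, `W` (whose `n`-th terms are used for the draw
number `n + 1`): a black ball is drawn when `U n ≤ Xₙ / (Xₙ + Yₙ)`. -/
def urn (μ ν : ProbabilityMeasure (Icc (0 : ℝ) β)) (U V W : ℕ → Ω → I) (p : Quadrant) :
    ℕ → Ω → Quadrant
  | 0, _ => p
  | n + 1, ω =>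
    if U n ω ≤ proportion (urn μ ν U V W p n ω) then
      addX (urn μ ν U V W p n ω) (quantile μ (V n ω))
    else
      addY (urn μ ν U V W p n ω) (quantile ν (W n ω))

/-- The proportion `Zₙ` of black balls. -/
def Z (μ ν : ProbabilityMeasure (Icc (0 : ℝ) β)) (U V W : ℕ → Ω → I) (p : Quadrant)
    (n : ℕ) (ω : Ω) : I :=
  proportion (urn μ ν U V W p n ω)

/-- The limit proportion: the upper limit of `Zₙ`, which is its limit wherever that exists. -/
def ZLim (μ ν : ProbabilityMeasure (Icc (0 : ℝ) β)) (U V W : ℕ → Ω → I) (p : Quadrant)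
    (ω : Ω) : I :=
  limsup (fun n => Z μ ν U V W p n ω) atTop

end Urn

lemma measurable_proportion : Measurable proportion := by
  refine Measurable.subtype_mk ?_
  fun_prop

lemma measurable_urn {Ω : Type*} [MeasurableSpace Ω] {β : ℝ}
    (μ ν : ProbabilityMeasure (Icc (0 : ℝ) β)) {U V W : ℕ → Ω → I}
    (hU : ∀ n, Measurable (U n)) (hV : ∀ n, Measurable (V n)) (hW : ∀ n, Measurable (W n))
    (p : Quadrant) (n : ℕ) : Measurable (urn μ ν U V W p n) := by
  induction n with
  | zero => exact measurable_const
  | succ n ih =>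
    have hX : Measurable fun ω => quantile μ (V n ω) :=
      (quantile_mono μ).measurable.comp (hV n)
    have hY : Measurable fun ω => quantile ν (W n ω) :=
      (quantile_mono ν).measurable.comp (hW n)
    refine Measurable.ite (measurableSet_le (hU n) (measurable_proportion.comp ih)) ?_ ?_
    · exact Measurable.subtype_mk (((measurable_fst.comp (measurable_subtype_coe.comp ih)).add
        (measurable_subtype_coe.comp hX)).prodMk (measurable_snd.comp (measurable_subtype_coe.comp ih)))
    · exact Measurable.subtype_mk ((measurable_fst.comp (measurable_subtype_coe.comp ih)).prodMk
        ((measurable_snd.comp (measurable_subtype_coe.comp ih)).add (measurable_subtype_coe.comp hY)))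

lemma measurable_ZLim {Ω : Type*} [MeasurableSpace Ω] {β : ℝ}
    (μ ν : ProbabilityMeasure (Icc (0 : ℝ) β)) {U V W : ℕ → Ω → I}
    (hU : ∀ n, Measurable (U n)) (hV : ∀ n, Measurable (V n)) (hW : ∀ n, Measurable (W n))
    (p : Quadrant) : Measurable (ZLim μ ν U V W p) :=
  Measurable.limsup fun n => measurable_proportion.comp (measurable_urn μ ν hU hV hW p n)

/-- The driving sequences of an urn: `(Uₙ)` is i.i.d. uniform on `[0, 1]`, `(Vₙ, Wₙ)` is an i.i.d.
sequence of random vectors with uniform components (of arbitrary dependence), and the two sequences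
are independent of each other. -/
structure IsDriving {Ω : Type*} [MeasurableSpace Ω] (P : Measure Ω) (U V W : ℕ → Ω → I) :
    Prop where
  measurable_U : ∀ n, Measurable (U n)
  measurable_V : ∀ n, Measurable (V n)
  measurable_W : ∀ n, Measurable (W n)
  law_U : ∀ n, P.map (U n) = volume
  law_V : ∀ n, P.map (V n) = volume
  law_W : ∀ n, P.map (W n) = volume
  indep_U : iIndepFun U P
  indep_VW : iIndepFun (fun n ω => (V n ω, W n ω)) P
  ident_VW : ∀ n, IdentDistrib (fun ω => (V n ω, W n ω)) (fun ω => (V 0 ω, W 0 ω)) P P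
  indep : IndepFun (fun ω n => U n ω) (fun ω n => (V n ω, W n ω)) P

/-- A concrete sample space carrying driving sequences. -/
abbrev SampleSpace : Type := (ℕ → I) × (ℕ → I × I)

/-- The law on the sample space under which all coordinates are independent and uniform. -/
def sampleLaw : ProbabilityMeasure SampleSpace :=
  ⟨(Measure.infinitePi fun _ : ℕ => (volume : Measure I)).prod
    (Measure.infinitePi fun _ : ℕ => (volume : Measure (I × I))), inferInstance⟩

/-- The map sending `(x, y)` to the law of the limit proportion of the urn with initial composition
`(x, y)` and reinforcement distributions `μ, ν`. -/
def limitLaw {β : ℝ} (μ ν : ProbabilityMeasure (Icc (0 : ℝ) β)) (p : Quadrant) :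
    ProbabilityMeasure I :=
  sampleLaw.map (f := ZLim μ ν (fun n ω => ω.1 n) (fun n ω => (ω.2 n).1) (fun n ω => (ω.2 n).2) p)
    (measurable_ZLim μ ν (fun n => by fun_prop) (fun n => by fun_prop) (fun n => by fun_prop)
      p).aemeasurable

end RRU

end

noncomputable section

namespace RRU

/-! ### The quantile function pushes the uniform distribution forward -/

/-! Write `S = x + y`, `z = x / S`, and let `T` be the operator `transition`, the expectation after
one draw. The proof links two descriptions of the urn: expectations along driving sequences, and the
iterates `T^n g`, which involve only `μ` and `ν` (`IsDriving.integral_urn`).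

Given `z` and `S`, the proportion drifts by `z (1 - z)` times the difference of the two means of `k
/ (S + k)`. Because `μ` and `ν` have equal means, the first-order terms cancel and the rest is
controlled by the expected decrease of `β / S`. Hence `Z - β / S` is a submartingale
(`le_transition_sub`) and `(Z - c)^2 + 3 β / S` has nonincreasing expectation
(`transition_sq_add_le`). Martingale convergence gives the almost sure limit; since `E f(Z_n) = T^n
(f ∘ proportion)` for continuous `f`, its law depends on `μ, ν` alone (`IsDriving.map_ZLim`). Taking
`c = z` bounds the second moment of the limit about `z` by `3 β / S`, hence the Wasserstein distance
by `√(3 β / S)`. This yields the explicit estimate and the behaviour at infinity.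

The limits `Λ f (p) = ∫ f d(limitLaw p)` are fixed by `T`. Extended from continuous functions to
Borel sets (`measurable_and_transition_limitLaw`) and multiplied by `S`, this is the functional
equation. Each axis is preserved by the urn, which gives the boundary values.

For continuity, `E[1 / (1 + S_n)]` tends to `0` uniformly in the initial composition, because the
common mean is positive. With the second moment bound this makes `T^n (f ∘ proportion)` converge to
`Λ f` uniformly for Lipschitz `f` (`tendstoUniformly_iterate_transition`). So `Λ f` is continuous,
the laws vary weakly continuously, and weak convergence on a bounded interval implies convergence in
`dW`. -/

lemma distFun_eq_cdf {β : ℝ} (ξ : ProbabilityMeasure (Icc (0 : ℝ) β)) (t : ℝ) :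
    distFun ξ t = cdf ((ξ : Measure (Icc (0 : ℝ) β)).map Subtype.val) t := by
  have := Measure.isProbabilityMeasure_map (μ := (ξ : Measure (Icc (0 : ℝ) β)))
    measurable_subtype_coe.aemeasurable
  rw [cdf_eq_real, map_measureReal_apply measurable_subtype_coe measurableSet_Iic]
  rfl

lemma distFun_mono {β : ℝ} (ξ : ProbabilityMeasure (Icc (0 : ℝ) β)) : Monotone (distFun ξ) := by
  intro s t hst
  simp only [distFun_eq_cdf]
  exact monotone_cdf _ hst

lemma distFun_nonneg {β : ℝ} (ξ : ProbabilityMeasure (Icc (0 : ℝ) β)) (t : ℝ) :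
    0 ≤ distFun ξ t := measureReal_nonneg

lemma distFun_le_one {β : ℝ} (ξ : ProbabilityMeasure (Icc (0 : ℝ) β)) (t : ℝ) :
    distFun ξ t ≤ 1 := measureReal_le_one

/-- Right continuity of the distribution function makes the infimum defining the quantile attained;
this is what the forward implication needs. -/
lemma quantile_le_iff {β : ℝ} (ξ : ProbabilityMeasure (Icc (0 : ℝ) β)) (t : I)
    (z : Icc (0 : ℝ) β) : quantile ξ t ≤ z ↔ (t : ℝ) ≤ distFun ξ z := by
  constructor
  · intro h
    have h' : sInf {z : ℝ | 0 ≤ z ∧ (t : ℝ) ≤ distFun ξ z} ≤ (z : ℝ) := h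
    have hlt : ∀ w : ℝ, (z : ℝ) < w → (t : ℝ) ≤ distFun ξ w := by
      intro w hw
      obtain ⟨v, ⟨-, hv⟩, hvw⟩ := exists_lt_of_csInf_lt
        (s := {z : ℝ | 0 ≤ z ∧ (t : ℝ) ≤ distFun ξ z})
        ⟨β, bound_nonneg ξ, by rw [distFun_self]; exact t.2.2⟩ (h'.trans_lt hw)
      exact hv.trans (distFun_mono ξ hvw.le)
    have hc : Tendsto (distFun ξ) (𝓝[>] (z : ℝ)) (𝓝 (distFun ξ z)) := by
      have := (cdf ((ξ : Measure (Icc (0 : ℝ) β)).map Subtype.val)).right_continuous z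
      have h2 : distFun ξ = cdf ((ξ : Measure (Icc (0 : ℝ) β)).map Subtype.val) :=
        funext (distFun_eq_cdf ξ)
      rw [h2]
      exact this.tendsto.mono_left (nhdsWithin_mono _ Ioi_subset_Ici_self)
    exact ge_of_tendsto hc (eventually_mem_nhdsWithin.mono fun w hw => hlt w hw)
  · intro h
    have : sInf {z : ℝ | 0 ≤ z ∧ (t : ℝ) ≤ distFun ξ z} ≤ (z : ℝ) :=
      csInf_le ⟨0, fun _ hz => hz.1⟩ ⟨z.2.1, h⟩
    exact this

lemma map_quantile {β : ℝ} (ξ : ProbabilityMeasure (Icc (0 : ℝ) β)) :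
    (volume : Measure I).map (quantile ξ) = ξ := by
  have := Measure.isProbabilityMeasure_map (μ := (volume : Measure I))
    (quantile_mono ξ).measurable.aemeasurable
  refine Measure.ext_of_Iic _ _ fun z => ?_
  rw [Measure.map_apply (quantile_mono ξ).measurable measurableSet_Iic]
  have : quantile ξ ⁻¹' Iic z = Iic (⟨distFun ξ z, distFun_nonneg ξ z, distFun_le_one ξ z⟩ : I) := by
    ext t
    simp only [mem_preimage, mem_Iic, quantile_le_iff]
    rfl
  rw [this, unitInterval.volume_Iic]
  exact ofReal_measureReal

/-! ### Functions bounded away from the origin and the transition operator -/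

/-- The total mass of an urn. -/
def total (p : Quadrant) : ℝ := p.1.1 + p.1.2

lemma total_pos (p : Quadrant) : 0 < total p := p.sum_pos

lemma total_addX {β : ℝ} (p : Quadrant) (k : Icc (0 : ℝ) β) : total (addX p k) = total p + k := by
  simp only [total, addX]; ring

lemma total_addY {β : ℝ} (p : Quadrant) (k : Icc (0 : ℝ) β) : total (addY p k) = total p + k := by
  simp only [total, addY]; ring

lemma total_le_addX {β : ℝ} (p : Quadrant) (k : Icc (0 : ℝ) β) : total p ≤ total (addX p k) := by
  rw [total_addX]; linarith [k.2.1]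

lemma total_le_addY {β : ℝ} (p : Quadrant) (k : Icc (0 : ℝ) β) : total p ≤ total (addY p k) := by
  rw [total_addY]; linarith [k.2.1]

lemma continuous_total : Continuous total := by unfold total; fun_prop

lemma continuous_proportion : Continuous proportion := by
  refine Continuous.subtype_mk ?_ _
  exact (by fun_prop : Continuous fun p : Quadrant => p.1.1).div continuous_total
    fun p => (total_pos p).ne'

lemma continuous_addX {β : ℝ} : Continuous fun q : Quadrant × Icc (0 : ℝ) β => addX q.1 q.2 :=
  Continuous.subtype_mk (by fun_prop) _

lemma continuous_addY {β : ℝ} : Continuous fun q : Quadrant × Icc (0 : ℝ) β => addY q.1 q.2 :=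
  Continuous.subtype_mk (by fun_prop) _

/-- Measurable functions on the quadrant that are bounded where the total mass is bounded below. -/
structure BddAway (g : Quadrant → ℝ) : Prop where
  measurable : Measurable g
  bounded : ∀ c : ℝ, 0 < c → ∃ M : ℝ, ∀ q : Quadrant, c ≤ total q → |g q| ≤ M

lemma BddAway.of_bound {g : Quadrant → ℝ} (hg : Measurable g) {M : ℝ} (h : ∀ q, |g q| ≤ M) :
    BddAway g := ⟨hg, fun _ _ => ⟨M, fun q _ => h q⟩⟩

lemma BddAway.add {f g : Quadrant → ℝ} (hf : BddAway f) (hg : BddAway g) :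
    BddAway fun q => f q + g q := by
  refine ⟨hf.measurable.add hg.measurable, fun c hc => ?_⟩
  obtain ⟨M, hM⟩ := hf.bounded c hc
  obtain ⟨N, hN⟩ := hg.bounded c hc
  exact ⟨M + N, fun q hq => (abs_add_le _ _).trans (add_le_add (hM q hq) (hN q hq))⟩

lemma BddAway.const_mul {f : Quadrant → ℝ} (hf : BddAway f) (a : ℝ) :
    BddAway fun q => a * f q := by
  refine ⟨hf.measurable.const_mul a, fun c hc => ?_⟩
  obtain ⟨M, hM⟩ := hf.bounded c hc
  exact ⟨|a| * M, fun q hq => by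
    rw [abs_mul]; exact mul_le_mul_of_nonneg_left (hM q hq) (abs_nonneg a)⟩

lemma BddAway.sub {f g : Quadrant → ℝ} (hf : BddAway f) (hg : BddAway g) :
    BddAway fun q => f q - g q := by
  simpa [sub_eq_add_neg] using hf.add (hg.const_mul (-1))

/-- The compensator `1 / S` is unbounded near the origin, but `S` never decreases along the urn, so
a bound on the region `c ≤ S` suffices for every integral that occurs. -/
lemma BddAway.integrable_comp {f : Quadrant → ℝ} (hf : BddAway f) {E : Type*} [MeasurableSpace E]
    {P : Measure E} [IsFiniteMeasure P] {c : ℝ} (hc : 0 < c) {Y : E → Quadrant}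
    (hY : Measurable Y) (h : ∀ e, c ≤ total (Y e)) : Integrable (fun e => f (Y e)) P := by
  obtain ⟨M, hM⟩ := hf.bounded c hc
  exact Integrable.of_bound (hf.measurable.comp hY).aestronglyMeasurable M
    (ae_of_all _ fun e => hM _ (h e))

variable {β : ℝ}

lemma measurable_addX (p : Quadrant) : Measurable fun k : Icc (0 : ℝ) β => addX p k :=
  continuous_addX.measurable.comp measurable_prodMk_left

lemma measurable_addY (p : Quadrant) : Measurable fun k : Icc (0 : ℝ) β => addY p k :=
  continuous_addY.measurable.comp measurable_prodMk_left

lemma BddAway.integrable_addX {f : Quadrant → ℝ} (hf : BddAway f)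
    (μ : ProbabilityMeasure (Icc (0 : ℝ) β)) (p : Quadrant) :
    Integrable (fun k => f (addX p k)) (μ : Measure (Icc (0 : ℝ) β)) :=
  hf.integrable_comp (total_pos p) (measurable_addX p)
    fun k => total_le_addX p k

lemma BddAway.integrable_addY {f : Quadrant → ℝ} (hf : BddAway f)
    (ν : ProbabilityMeasure (Icc (0 : ℝ) β)) (p : Quadrant) :
    Integrable (fun k => f (addY p k)) (ν : Measure (Icc (0 : ℝ) β)) :=
  hf.integrable_comp (total_pos p) (measurable_addY p)
    fun k => total_le_addY p k

/-- The transition operator of the urn, acting on functions of the composition. -/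
def transition (μ ν : ProbabilityMeasure (Icc (0 : ℝ) β)) (g : Quadrant → ℝ) (p : Quadrant) : ℝ :=
  (proportion p : ℝ) * ∫ k, g (addX p k) ∂(μ : Measure (Icc (0 : ℝ) β))
    + (1 - (proportion p : ℝ)) * ∫ k, g (addY p k) ∂(ν : Measure (Icc (0 : ℝ) β))

variable (μ ν : ProbabilityMeasure (Icc (0 : ℝ) β))

lemma transition_add {f g : Quadrant → ℝ} (hf : BddAway f) (hg : BddAway g) (p : Quadrant) :
    transition μ ν (fun q => f q + g q) p = transition μ ν f p + transition μ ν g p := by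
  simp only [transition]
  rw [integral_add (hf.integrable_addX μ p) (hg.integrable_addX μ p),
    integral_add (hf.integrable_addY ν p) (hg.integrable_addY ν p)]
  ring

lemma transition_const_mul (f : Quadrant → ℝ) (a : ℝ) (p : Quadrant) :
    transition μ ν (fun q => a * f q) p = a * transition μ ν f p := by
  simp only [transition, integral_const_mul]
  ring

lemma transition_sub {f g : Quadrant → ℝ} (hf : BddAway f) (hg : BddAway g) (p : Quadrant) :
    transition μ ν (fun q => f q - g q) p = transition μ ν f p - transition μ ν g p := by
  have := transition_add μ ν hf (hg.const_mul (-1)) p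
  rw [transition_const_mul] at this
  simpa [sub_eq_add_neg] using this

lemma transition_const (a : ℝ) (p : Quadrant) : transition μ ν (fun _ => a) p = a := by
  simp only [transition, integral_const, probReal_univ, one_smul]
  ring

lemma abs_transition_le {g : Quadrant → ℝ} {M : ℝ} {p : Quadrant}
    (h : ∀ q, total p ≤ total q → |g q| ≤ M) : |transition μ ν g p| ≤ M := by
  have h1 : |∫ k, g (addX p k) ∂(μ : Measure (Icc (0 : ℝ) β))| ≤ M := by
    have := norm_integral_le_of_norm_le_const (μ := (μ : Measure (Icc (0 : ℝ) β)))
      (f := fun k => g (addX p k)) (ae_of_all _ fun k => h (addX p k) (total_le_addX p k))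
    simpa using this
  have h2 : |∫ k, g (addY p k) ∂(ν : Measure (Icc (0 : ℝ) β))| ≤ M := by
    have := norm_integral_le_of_norm_le_const (μ := (ν : Measure (Icc (0 : ℝ) β)))
      (f := fun k => g (addY p k)) (ae_of_all _ fun k => h (addY p k) (total_le_addY p k))
    simpa using this
  have h3 := (proportion p).2.1
  have h4 := (proportion p).2.2
  rw [abs_le] at *
  rw [transition]
  constructor <;> nlinarith [mul_le_mul_of_nonneg_left h1.1 h3, mul_le_mul_of_nonneg_left h1.2 h3,
    mul_le_mul_of_nonneg_left h2.1 (sub_nonneg.2 h4),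
    mul_le_mul_of_nonneg_left h2.2 (sub_nonneg.2 h4)]

lemma BddAway.transition {g : Quadrant → ℝ} (hg : BddAway g) : BddAway (transition μ ν g) := by
  refine ⟨?_, fun c hc => ?_⟩
  · have hz : Measurable fun p : Quadrant => (proportion p : ℝ) :=
      measurable_subtype_coe.comp measurable_proportion
    refine (hz.mul ?_).add ((measurable_const.sub hz).mul ?_)
    · exact (StronglyMeasurable.integral_prod_right' (f := fun q : _ × _ => g (addX q.1 q.2))
        (hg.measurable.comp continuous_addX.measurable).stronglyMeasurable (ν := (μ : Measure (Icc (0 : ℝ) β)))).measurable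
    · exact (StronglyMeasurable.integral_prod_right' (f := fun q : _ × _ => g (addY q.1 q.2))
        (hg.measurable.comp continuous_addY.measurable).stronglyMeasurable (ν := (ν : Measure (Icc (0 : ℝ) β)))).measurable
  · obtain ⟨M, hM⟩ := hg.bounded c hc
    exact ⟨M, fun p hp => abs_transition_le μ ν fun q hq => hM q (hp.trans hq)⟩

lemma continuous_transition {g : Quadrant → ℝ} (hg : Continuous g) {M : ℝ} (h : ∀ q, |g q| ≤ M) :
    Continuous (transition μ ν g) := by
  have hz : Continuous fun p : Quadrant => (proportion p : ℝ) :=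
    continuous_subtype_val.comp continuous_proportion
  refine (hz.mul ?_).add ((continuous_const.sub hz).mul ?_)
  · refine continuous_of_dominated (bound := fun _ => M)
      (fun p => (hg.measurable.comp (measurable_addX p)).aestronglyMeasurable)
      (fun p => ae_of_all _ fun k => h _) (integrable_const M) (ae_of_all _ fun k => ?_)
    exact hg.comp (continuous_addX.comp (by fun_prop : Continuous fun p : Quadrant => (p, k)))
  · refine continuous_of_dominated (bound := fun _ => M)
      (fun p => (hg.measurable.comp (measurable_addY p)).aestronglyMeasurable)
      (fun p => ae_of_all _ fun k => h _) (integrable_const M) (ae_of_all _ fun k => ?_)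
    exact hg.comp (continuous_addY.comp (by fun_prop : Continuous fun p : Quadrant => (p, k)))

/-! ### One draw from the urn -/

/-- The composition after one draw from an urn of composition `p`. -/
def step (p : Quadrant) (ζ : I × I × I) : Quadrant :=
  if ζ.1 ≤ proportion p then addX p (quantile μ ζ.2.1) else addY p (quantile ν ζ.2.2)

lemma total_le_step (p : Quadrant) (ζ : I × I × I) : total p ≤ total (step μ ν p ζ) := by
  unfold step
  split_ifs
  · exact total_le_addX p _
  · exact total_le_addY p _

lemma measurable_step : Measurable fun q : Quadrant × (I × I × I) => step μ ν q.1 q.2 := by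
  refine Measurable.ite (measurableSet_le (by fun_prop) (measurable_proportion.comp measurable_fst))
    ?_ ?_
  · exact continuous_addX.measurable.comp (measurable_fst.prodMk
      ((quantile_mono μ).measurable.comp (by fun_prop)))
  · exact continuous_addY.measurable.comp (measurable_fst.prodMk
      ((quantile_mono ν).measurable.comp (by fun_prop)))

/-- A draw uses only one of the two components of `κ`, depending on the colour. Hence only the
marginals of `κ` enter, and their dependence is irrelevant. -/
lemma integral_step {κ : Measure (I × I)} [IsProbabilityMeasure κ]
    (h1 : κ.map Prod.fst = volume) (h2 : κ.map Prod.snd = volume)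
    {g : Quadrant → ℝ} (hg : BddAway g) (p : Quadrant) :
    ∫ ζ, g (step μ ν p ζ) ∂((volume : Measure I).prod κ) = transition μ ν g p := by
  have hX : ∫ x, g (addX p (quantile μ x.1)) ∂κ
      = ∫ k, g (addX p k) ∂(μ : Measure (Icc (0 : ℝ) β)) := by
    have hm : Measurable fun k : Icc (0 : ℝ) β => g (addX p k) :=
      hg.measurable.comp (measurable_addX p)
    rw [← map_quantile μ, ← h1, Measure.map_map (quantile_mono μ).measurable measurable_fst,
      integral_map ((quantile_mono μ).measurable.comp measurable_fst).aemeasurable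
        hm.aestronglyMeasurable]
    rfl
  have hY : ∫ x, g (addY p (quantile ν x.2)) ∂κ
      = ∫ k, g (addY p k) ∂(ν : Measure (Icc (0 : ℝ) β)) := by
    have hm : Measurable fun k : Icc (0 : ℝ) β => g (addY p k) :=
      hg.measurable.comp (measurable_addY p)
    rw [← map_quantile ν, ← h2, Measure.map_map (quantile_mono ν).measurable measurable_snd,
      integral_map ((quantile_mono ν).measurable.comp measurable_snd).aemeasurable
        hm.aestronglyMeasurable]
    rfl
  have hiX : Integrable (fun x : I × I => g (addX p (quantile μ x.1))) κ :=
    hg.integrable_comp (total_pos p)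
      ((measurable_addX p).comp ((quantile_mono μ).measurable.comp measurable_fst))
      fun x => total_le_addX p _
  have hiY : Integrable (fun x : I × I => g (addY p (quantile ν x.2))) κ :=
    hg.integrable_comp (total_pos p)
      ((measurable_addY p).comp ((quantile_mono ν).measurable.comp measurable_snd))
      fun x => total_le_addY p _
  have hind : ∀ s : Set I, MeasurableSet s → Integrable (s.indicator (1 : I → ℝ)) volume :=
    fun s hs => (integrable_indicator_iff hs).2 (integrable_const (1 : ℝ)).integrableOn
  -- Splitting by colour makes each term a product of a function of the first coordinate and a
  -- function of the other two, so the integral over the product measure factors.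
  have hrw : (fun ζ : I × I × I => g (step μ ν p ζ)) = fun ζ =>
      (Iic (proportion p)).indicator 1 ζ.1 * g (addX p (quantile μ ζ.2.1))
        + (Ioi (proportion p)).indicator 1 ζ.1 * g (addY p (quantile ν ζ.2.2)) := by
    funext ζ
    by_cases h : ζ.1 ≤ proportion p
    · simp [step, h]
    · simp [step, h, not_le.1 h]
  rw [hrw, integral_add ((hind _ measurableSet_Iic).mul_prod hiX)
    ((hind _ measurableSet_Ioi).mul_prod hiY),
    integral_prod_mul (fun u : I => (Iic (proportion p)).indicator (1 : I → ℝ) u)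
      (fun x : I × I => g (addX p (quantile μ x.1))),
    integral_prod_mul (fun u : I => (Ioi (proportion p)).indicator (1 : I → ℝ) u)
      (fun x : I × I => g (addY p (quantile ν x.2))), hX, hY,
    integral_indicator_one measurableSet_Iic, integral_indicator_one measurableSet_Ioi]
  simp only [Measure.real, unitInterval.volume_Iic, unitInterval.volume_Ioi]
  rw [ENNReal.toReal_ofReal (proportion p).2.1,
    ENNReal.toReal_ofReal (sub_nonneg.2 (proportion p).2.2)]
  rfl

/-! ### Driving sequences and the Markov property -/

/-- The randomness used for one draw. -/
def draw {Ω : Type*} (U V W : ℕ → Ω → I) (n : ℕ) (ω : Ω) : I × I × I := (U n ω, V n ω, W n ω)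

lemma urn_succ {Ω : Type*} {U V W : ℕ → Ω → I} {β : ℝ}
    (μ ν : ProbabilityMeasure (Icc (0 : ℝ) β)) (p : Quadrant) (n : ℕ) (ω : Ω) :
    urn μ ν U V W p (n + 1) ω = step μ ν (urn μ ν U V W p n ω) (draw U V W n ω) := rfl

lemma total_le_urn {Ω : Type*} {U V W : ℕ → Ω → I} {β : ℝ}
    (μ ν : ProbabilityMeasure (Icc (0 : ℝ) β)) (p : Quadrant) (n : ℕ) (ω : Ω) :
    total p ≤ total (urn μ ν U V W p n ω) := by
  induction n with
  | zero => exact le_rfl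
  | succ n ih => rw [urn_succ]; exact ih.trans (total_le_step μ ν _ _)

section Driving

variable {Ω : Type*} [MeasurableSpace Ω] {P : Measure Ω} {U V W : ℕ → Ω → I} {β : ℝ}

lemma IsDriving.measurable_draw (h : IsDriving P U V W) (n : ℕ) : Measurable (draw U V W n) :=
  (h.measurable_U n).prodMk ((h.measurable_V n).prodMk (h.measurable_W n))

/-- Measurable rectangles form a generating π-system. On them a finite intersection separates into
an event of the `U` sequence and one of the `(V, W)` sequence, and the three independence
assumptions factor it completely. -/
lemma IsDriving.iIndepFun_draw [IsProbabilityMeasure P] (h : IsDriving P U V W) :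
    iIndepFun (draw U V W) P := by
  rw [iIndepFun_iff_iIndep]
  refine iIndepSets.iIndep (fun n => (h.measurable_draw n).comap_le)
    (fun n => preimage (draw U V W n) ''
      image2 (· ×ˢ ·) {s : Set I | MeasurableSet s} {t : Set (I × I) | MeasurableSet t})
    (fun n => ?_) (fun n => ?_) ?_
  · exact isPiSystem_prod.comap _
  · rw [← generateFrom_prod, MeasurableSpace.comap_generateFrom]
  · rw [iIndepSets_iff]
    intro S f hf
    have hf' : ∀ n, ∃ A : Set I, ∃ B : Set (I × I), MeasurableSet A ∧ MeasurableSet B ∧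
        (n ∈ S → f n = U n ⁻¹' A ∩ (fun ω => (V n ω, W n ω)) ⁻¹' B) := by
      intro n
      by_cases hn : n ∈ S
      · obtain ⟨-, ⟨A, hA, B, hB, rfl⟩, h⟩ := hf n hn
        exact ⟨A, B, hA, hB, fun _ => by rw [← h]; rfl⟩
      · exact ⟨∅, ∅, .empty, .empty, fun hn' => absurd hn' hn⟩
    choose A B hA hB hfe using hf'
    have e1 : ⋂ n ∈ S, f n = (fun ω n => U n ω) ⁻¹' (⋂ n ∈ S, (fun u : ℕ → I => u n) ⁻¹' A n) ∩
        (fun ω n => (V n ω, W n ω)) ⁻¹' (⋂ n ∈ S, (fun u : ℕ → I × I => u n) ⁻¹' B n) := by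
      ext ω
      simp only [mem_iInter, mem_inter_iff, mem_preimage]
      constructor
      · intro hω
        exact ⟨fun n hn => (hfe n hn ▸ hω n hn).1, fun n hn => (hfe n hn ▸ hω n hn).2⟩
      · intro hω n hn
        rw [hfe n hn]
        exact ⟨hω.1 n hn, hω.2 n hn⟩
    rw [e1, h.indep.measure_inter_preimage_eq_mul _ _
      (S.measurableSet_biInter fun n _ => measurable_pi_apply n (hA n))
      (S.measurableSet_biInter fun n _ => measurable_pi_apply n (hB n))]
    simp only [preimage_iInter]
    have e2 := h.indep_U.measure_inter_preimage_eq_mul (S := S) (sets := A) fun n _ => hA n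
    have e3 := h.indep_VW.measure_inter_preimage_eq_mul (S := S) (sets := B) fun n _ => hB n
    refine (congrArg₂ (· * ·) e2 e3).trans ?_
    rw [← Finset.prod_mul_distrib]
    refine Finset.prod_congr rfl fun n hn => ?_
    rw [hfe n hn]
    have e4 : IndepFun (U n) (fun ω => (V n ω, W n ω)) P :=
      h.indep.comp (measurable_pi_apply n) (measurable_pi_apply n)
    rw [e4.measure_inter_preimage_eq_mul _ _ (hA n) (hB n)]

lemma IsDriving.map_draw [IsProbabilityMeasure P] (h : IsDriving P U V W) (n : ℕ) :
    P.map (draw U V W n) = (volume : Measure I).prod (P.map fun ω => (V n ω, W n ω)) := by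
  have e4 : IndepFun (U n) (fun ω => (V n ω, W n ω)) P :=
    h.indep.comp (measurable_pi_apply n) (measurable_pi_apply n)
  have := (indepFun_iff_map_prod_eq_prod_map_map (h.measurable_U n).aemeasurable
    ((h.measurable_V n).prodMk (h.measurable_W n)).aemeasurable).1 e4
  rw [h.law_U n] at this
  exact this

lemma IsDriving.integral_step [IsProbabilityMeasure P] (h : IsDriving P U V W)
    (μ ν : ProbabilityMeasure (Icc (0 : ℝ) β)) {g : Quadrant → ℝ} (hg : BddAway g) (n : ℕ)
    (p : Quadrant) :
    ∫ ζ, g (step μ ν p ζ) ∂(P.map (draw U V W n)) = transition μ ν g p := by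
  have hm : Measurable fun ω => (V n ω, W n ω) := (h.measurable_V n).prodMk (h.measurable_W n)
  have := Measure.isProbabilityMeasure_map (μ := P) hm.aemeasurable
  rw [h.map_draw n]
  refine RRU.integral_step μ ν ?_ ?_ hg p
  · rw [Measure.map_map measurable_fst hm, ← h.law_V n]; rfl
  · rw [Measure.map_map measurable_snd hm, ← h.law_W n]; rfl

/-- The information available before each draw. -/
def past (h : IsDriving P U V W) : Filtration ℕ (inferInstance : MeasurableSpace Ω) where
  seq n := ⨆ i < n, MeasurableSpace.comap (draw U V W i) inferInstance
  mono' _ _ hnm := biSup_mono fun _ hi => lt_of_lt_of_le hi hnm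
  le' _ := iSup₂_le fun i _ => (h.measurable_draw i).comap_le

lemma indep_past [IsProbabilityMeasure P] (h : IsDriving P U V W) (n : ℕ) :
    Indep (past h n) (MeasurableSpace.comap (draw U V W n) inferInstance) P := by
  have := indep_iSup_of_disjoint (fun i => (h.measurable_draw i).comap_le)
    ((iIndepFun_iff_iIndep _ _ _).1 h.iIndepFun_draw) (S := {i | i < n}) (T := {n}) (by simp)
  rwa [iSup_singleton] at this

lemma measurable_past_urn (h : IsDriving P U V W) (μ ν : ProbabilityMeasure (Icc (0 : ℝ) β))
    (p : Quadrant) (n : ℕ) : Measurable[past h n] (urn μ ν U V W p n) := by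
  induction n with
  | zero => exact measurable_const
  | succ n ih =>
    have h1 : Measurable[past h (n + 1)] (urn μ ν U V W p n) :=
      ih.mono ((past h).mono n.le_succ) le_rfl
    have h2 : Measurable[past h (n + 1)] (draw U V W n) :=
      (comap_measurable (draw U V W n)).mono
        (le_iSup₂_of_le n n.lt_succ_self le_rfl) le_rfl
    exact (measurable_step μ ν).comp (h1.prodMk h2)

lemma IsDriving.measurable_urn (h : IsDriving P U V W) (μ ν : ProbabilityMeasure (Icc (0 : ℝ) β))
    (p : Quadrant) (n : ℕ) : Measurable (urn μ ν U V W p n) :=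
  RRU.measurable_urn μ ν h.measurable_U h.measurable_V h.measurable_W p n

lemma IsDriving.integrable_urn [IsProbabilityMeasure P] (h : IsDriving P U V W)
    (μ ν : ProbabilityMeasure (Icc (0 : ℝ) β)) {g : Quadrant → ℝ} (hg : BddAway g) (p : Quadrant)
    (n : ℕ) : Integrable (fun ω => g (urn μ ν U V W p n ω)) P :=
  hg.integrable_comp (total_pos p) (h.measurable_urn μ ν p n) (total_le_urn μ ν p n)

/-- Markov property of the urn. -/
lemma IsDriving.setIntegral_urn_succ [IsProbabilityMeasure P] (h : IsDriving P U V W)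
    (μ ν : ProbabilityMeasure (Icc (0 : ℝ) β)) {g : Quadrant → ℝ} (hg : BddAway g) (p : Quadrant)
    (n : ℕ) {A : Set Ω} (hA : MeasurableSet[past h n] A) :
    ∫ ω in A, g (urn μ ν U V W p (n + 1) ω) ∂P
      = ∫ ω in A, transition μ ν g (urn μ ν U V W p n ω) ∂P := by
  have hA' : MeasurableSet A := (past h).le n A hA
  -- Carrying the indicator of `A` along with the composition gives a variable that is known before
  -- the draw and independent of it. Fubini then allows the draw to be integrated with `Y` frozen.
  let Y : Ω → Quadrant × ℝ := fun ω => (urn μ ν U V W p n ω, A.indicator (fun _ => 1) ω)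
  have hY : Measurable[past h n] Y :=
    (measurable_past_urn h μ ν p n).prodMk (Measurable.indicator (@measurable_const ℝ Ω _ (past h n) 1) hA)
  have hY' : Measurable Y := hY.mono ((past h).le n) le_rfl
  have hind : IndepFun Y (draw U V W n) P :=
    indep_of_indep_of_le_left (indep_past h n) hY.comap_le
  have hmap := (indepFun_iff_map_prod_eq_prod_map_map hY'.aemeasurable
    (h.measurable_draw n).aemeasurable).1 hind
  have := Measure.isProbabilityMeasure_map (μ := P) (h.measurable_draw n).aemeasurable
  have := Measure.isProbabilityMeasure_map (μ := P) hY'.aemeasurable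
  let G : (Quadrant × ℝ) × (I × I × I) → ℝ := fun q => q.1.2 * g (step μ ν q.1.1 q.2)
  have hG : Measurable G := (measurable_snd.comp measurable_fst).mul
    (hg.measurable.comp ((measurable_step μ ν).comp
      ((measurable_fst.comp measurable_fst).prodMk measurable_snd)))
  have hYd : Measurable fun ω => (Y ω, draw U V W n ω) := hY'.prodMk (h.measurable_draw n)
  have hGi : Integrable G ((P.map Y).prod (P.map (draw U V W n))) := by
    rw [← hmap, integrable_map_measure hG.aestronglyMeasurable hYd.aemeasurable]
    refine ((h.integrable_urn μ ν hg p (n + 1)).indicator hA').congr (ae_of_all _ fun ω => ?_)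
    by_cases hω : ω ∈ A <;> simp [G, Y, hω, urn_succ]
  calc ∫ ω in A, g (urn μ ν U V W p (n + 1) ω) ∂P
      = ∫ ω, G (Y ω, draw U V W n ω) ∂P := by
        rw [← integral_indicator hA']
        refine integral_congr_ae (ae_of_all _ fun ω => ?_)
        by_cases hω : ω ∈ A <;> simp [G, Y, hω, urn_succ]
    _ = ∫ q, G q ∂((P.map Y).prod (P.map (draw U V W n))) := by
        rw [← hmap, integral_map hYd.aemeasurable hG.aestronglyMeasurable]
    _ = ∫ y, y.2 * transition μ ν g y.1 ∂(P.map Y) := by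
        rw [integral_prod _ hGi]
        refine integral_congr_ae (ae_of_all _ fun y => ?_)
        simp only [G, integral_const_mul, h.integral_step μ ν hg]
    _ = ∫ ω, (Y ω).2 * transition μ ν g (Y ω).1 ∂P := by
        rw [integral_map hY'.aemeasurable]
        exact (measurable_snd.mul
          ((hg.transition μ ν).measurable.comp measurable_fst)).aestronglyMeasurable
    _ = ∫ ω in A, transition μ ν g (urn μ ν U V W p n ω) ∂P := by
        rw [← integral_indicator hA']
        refine integral_congr_ae (ae_of_all _ fun ω => ?_)
        by_cases hω : ω ∈ A <;> simp [Y, hω]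

lemma IsDriving.integral_urn_succ [IsProbabilityMeasure P] (h : IsDriving P U V W)
    (μ ν : ProbabilityMeasure (Icc (0 : ℝ) β)) {g : Quadrant → ℝ} (hg : BddAway g) (p : Quadrant)
    (n : ℕ) : ∫ ω, g (urn μ ν U V W p (n + 1) ω) ∂P
      = ∫ ω, transition μ ν g (urn μ ν U V W p n ω) ∂P := by
  simpa using h.setIntegral_urn_succ μ ν hg p n MeasurableSet.univ

lemma BddAway.iterate_transition (μ ν : ProbabilityMeasure (Icc (0 : ℝ) β)) {g : Quadrant → ℝ}
    (hg : BddAway g) (n : ℕ) : BddAway ((RRU.transition μ ν)^[n] g) := by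
  induction n with
  | zero => exact hg
  | succ n ih => rw [Function.iterate_succ_apply']; exact ih.transition μ ν

/-- The right side does not involve the probability space: this is the source of the uniqueness of
the limit law. -/
lemma IsDriving.integral_urn [IsProbabilityMeasure P] (h : IsDriving P U V W)
    (μ ν : ProbabilityMeasure (Icc (0 : ℝ) β)) {g : Quadrant → ℝ} (hg : BddAway g) (p : Quadrant)
    (n : ℕ) : ∫ ω, g (urn μ ν U V W p n ω) ∂P = (transition μ ν)^[n] g p := by
  induction n generalizing g with
  | zero => simp [urn]
  | succ n ih => rw [h.integral_urn_succ μ ν hg, ih (hg.transition μ ν), Function.iterate_succ_apply]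

end Driving

/-- Makes every result on driving sequences available for `limitLaw`, and provides one fixed space
on which iterates of `T` can be read as expectations. -/
lemma isDriving_sampleLaw : IsDriving (sampleLaw : Measure SampleSpace)
    (fun n ω => ω.1 n) (fun n ω => (ω.2 n).1) (fun n ω => (ω.2 n).2) := by
  set P1 : Measure (ℕ → I) := Measure.infinitePi fun _ : ℕ => (volume : Measure I) with hP1
  set P2 : Measure (ℕ → I × I) :=
    Measure.infinitePi fun _ : ℕ => (volume : Measure (I × I)) with hP2
  have hP : (sampleLaw : Measure SampleSpace) = P1.prod P2 := rfl
  have hfst : (sampleLaw : Measure SampleSpace).map Prod.fst = P1 := by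
    rw [hP, Measure.map_fst_prod]; simp
  have hsnd : (sampleLaw : Measure SampleSpace).map Prod.snd = P2 := by
    rw [hP, Measure.map_snd_prod]; simp
  have hU : ∀ n, (sampleLaw : Measure SampleSpace).map (fun ω => ω.1 n) = volume := by
    intro n
    rw [← Measure.infinitePi_map_eval (fun _ : ℕ => (volume : Measure I)) n, ← hP1, ← hfst,
      Measure.map_map (measurable_pi_apply n) measurable_fst]
    rfl
  have hVW : ∀ n, (sampleLaw : Measure SampleSpace).map (fun ω => ω.2 n) = volume := by
    intro n
    rw [← Measure.infinitePi_map_eval (fun _ : ℕ => (volume : Measure (I × I))) n, ← hP2, ← hsnd,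
      Measure.map_map (measurable_pi_apply n) measurable_snd]
    rfl
  have hm : ∀ n, Measurable fun ω : SampleSpace => ω.2 n := fun n => by fun_prop
  refine ⟨fun n => by fun_prop, fun n => by fun_prop, fun n => by fun_prop, hU, fun n => ?_,
    fun n => ?_, ?_, ?_, fun n => ⟨by fun_prop, by fun_prop, ?_⟩, ?_⟩
  · have := congrArg (Measure.map Prod.fst) (hVW n)
    rw [Measure.map_map measurable_fst (hm n), Measure.volume_eq_prod, Measure.map_fst_prod] at this
    simpa using! this
  · have := congrArg (Measure.map Prod.snd) (hVW n)
    rw [Measure.map_map measurable_snd (hm n), Measure.volume_eq_prod, Measure.map_snd_prod] at this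
    simpa using! this
  · rw [iIndepFun_iff_map_fun_eq_infinitePi_map fun n => by fun_prop]
    simp only [hU]
    exact hfst
  · rw [iIndepFun_iff_map_fun_eq_infinitePi_map fun n => by fun_prop]
    simp only [Prod.mk.eta, hVW]
    exact hsnd
  · simp only [Prod.mk.eta, hVW]
  · rw [indepFun_iff_map_prod_eq_prod_map_map (by fun_prop) (by fun_prop)]
    have e1 : (sampleLaw : Measure SampleSpace).map (fun ω n => ω.1 n) = P1 := hfst
    have e2 : (sampleLaw : Measure SampleSpace).map (fun ω n => ω.2 n) = P2 := hsnd
    simp only [Prod.mk.eta]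
    rw [e1, e2, ← hP]
    exact Measure.map_id

/-! ### Drift estimates -/

section Drift

variable {β : ℝ}

/-- The last factor is `k / (S + k)`, written so that it is affine in `1 / (S + k)`. All drift
computations then reduce to the single integral of `(S + k)⁻¹`. -/
lemma proportion_addX (p : Quadrant) (k : Icc (0 : ℝ) β) :
    (proportion (addX p k) : ℝ)
      = proportion p + (1 - proportion p) * (1 - total p * (total (addX p k))⁻¹) := by
  have h1 := (total_pos p).ne'
  have h2 := (total_pos (addX p k)).ne'
  change (p.1.1 + k) / total (addX p k)
    = p.1.1 / total p + (1 - p.1.1 / total p) * (1 - total p * (total (addX p k))⁻¹)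
  have h3 : p.1.1 + (k : ℝ) = total (addX p k) - p.1.2 := by rw [total_addX, total]; ring
  have h4 : p.1.2 = total p - p.1.1 := by rw [total]; ring
  rw [h3, h4]
  field_simp
  ring

lemma proportion_addY (p : Quadrant) (k : Icc (0 : ℝ) β) :
    (proportion (addY p k) : ℝ)
      = proportion p - proportion p * (1 - total p * (total (addY p k))⁻¹) := by
  have h1 := (total_pos p).ne'
  have h2 := (total_pos (addY p k)).ne'
  change p.1.1 / total (addY p k)
    = p.1.1 / total p - p.1.1 / total p * (1 - total p * (total (addY p k))⁻¹)
  field_simp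
  ring

lemma bddAway_inv_total : BddAway fun q => (total q)⁻¹ := by
  refine ⟨continuous_total.measurable.inv, fun c hc => ⟨c⁻¹, fun q hq => ?_⟩⟩
  rw [abs_of_pos (inv_pos.2 (total_pos q))]
  exact inv_anti₀ hc hq

lemma bddAway_comp_proportion {f : I → ℝ} (hf : Continuous f) :
    BddAway fun q => f (proportion q) := by
  obtain ⟨M, hM⟩ := isCompact_univ.exists_bound_of_continuousOn hf.continuousOn
  exact .of_bound (hf.measurable.comp measurable_proportion) fun q => hM _ (mem_univ _)

lemma integrable_coe (ξ : ProbabilityMeasure (Icc (0 : ℝ) β)) :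
    Integrable (fun k : Icc (0 : ℝ) β => (k : ℝ)) (ξ : Measure (Icc (0 : ℝ) β)) :=
  Integrable.of_bound measurable_subtype_coe.aestronglyMeasurable β
    (ae_of_all _ fun k => by rw [Real.norm_eq_abs, abs_of_nonneg k.2.1]; exact k.2.2)

lemma integrable_inv_add (ξ : ProbabilityMeasure (Icc (0 : ℝ) β)) {S : ℝ} (hS : 0 < S) :
    Integrable (fun k : Icc (0 : ℝ) β => (S + k)⁻¹) (ξ : Measure (Icc (0 : ℝ) β)) := by
  refine Integrable.of_bound (by fun_prop) S⁻¹ (ae_of_all _ fun k => ?_)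
  have hk := k.2.1
  rw [Real.norm_eq_abs, abs_of_pos (inv_pos.2 (by linarith))]
  exact inv_anti₀ hS (by linarith)

lemma integral_inv_add_le (ξ : ProbabilityMeasure (Icc (0 : ℝ) β)) {S : ℝ} (hS : 0 < S) :
    ∫ k : Icc (0 : ℝ) β, (S + k)⁻¹ ∂(ξ : Measure (Icc (0 : ℝ) β)) ≤ S⁻¹ := by
  have := integral_mono (integrable_inv_add ξ hS) (integrable_const S⁻¹)
    fun k : Icc (0 : ℝ) β => inv_anti₀ hS (by linarith [k.2.1] : S ≤ S + k)
  simpa using this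

lemma one_sub_integral_inv_add_le (ξ : ProbabilityMeasure (Icc (0 : ℝ) β)) {S : ℝ} (hS : 0 < S) :
    1 - S * ∫ k : Icc (0 : ℝ) β, (S + k)⁻¹ ∂(ξ : Measure (Icc (0 : ℝ) β)) ≤ mean ξ * S⁻¹ := by
  have := integral_mono ((integrable_const (1 : ℝ)).sub ((integrable_inv_add ξ hS).const_mul S))
    ((integrable_coe ξ).mul_const S⁻¹) fun k : Icc (0 : ℝ) β => by
      have hk := k.2.1
      have : 0 < S + k := by linarith
      change 1 - S * (S + k : ℝ)⁻¹ ≤ k * S⁻¹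
      have e : (k : ℝ) * S⁻¹ - (1 - S * (S + k)⁻¹) = k ^ 2 / (S * (S + k)) := by
        field_simp; ring
      have : 0 ≤ (k : ℝ) ^ 2 / (S * (S + k)) := by positivity
      linarith
  simp only [Pi.sub_apply] at this
  rw [integral_sub (integrable_const _) ((integrable_inv_add ξ hS).const_mul S),
    integral_const_mul, integral_mul_const] at this
  simpa [mean] using this

/-- Since `k / S - k / (S + k) = k (1 / S - 1 / (S + k))` and `k ≤ β`, replacing `k / (S + k)` by `k
/ S` costs at most `β` times the expected decrease of `1 / S`, a quantity that telescopes along the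
urn. -/
lemma le_one_sub_integral_inv_add (ξ : ProbabilityMeasure (Icc (0 : ℝ) β)) {S : ℝ} (hS : 0 < S) :
    mean ξ * S⁻¹ - β * (S⁻¹ - ∫ k : Icc (0 : ℝ) β, (S + k)⁻¹ ∂(ξ : Measure (Icc (0 : ℝ) β)))
      ≤ 1 - S * ∫ k : Icc (0 : ℝ) β, (S + k)⁻¹ ∂(ξ : Measure (Icc (0 : ℝ) β)) := by
  have hi := integrable_inv_add ξ hS
  have := integral_mono (f := fun k : Icc (0 : ℝ) β => (k : ℝ) * S⁻¹)
    (g := fun k : Icc (0 : ℝ) β => (1 + β * S⁻¹) - (S + β) * (S + k : ℝ)⁻¹)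
    ((integrable_coe ξ).mul_const S⁻¹) ((integrable_const _).sub (hi.const_mul _))
    fun k => by
      have hk := k.2.1
      have hk' : 0 ≤ β - k := sub_nonneg.2 k.2.2
      have : 0 < S + k := by linarith
      have e : (1 + β * S⁻¹) - (S + β) * (S + k : ℝ)⁻¹ - (k : ℝ) * S⁻¹
          = k * (β - k) / (S * (S + k)) := by
        field_simp; ring
      have : 0 ≤ (k : ℝ) * (β - k) / (S * (S + k)) := by positivity
      change (k : ℝ) * S⁻¹ ≤ (1 + β * S⁻¹) - (S + β) * (S + k : ℝ)⁻¹
      linarith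
  rw [integral_sub (integrable_const _) (hi.const_mul _), integral_const_mul,
    integral_mul_const] at this
  simp only [integral_const, probReal_univ, one_smul] at this
  unfold mean
  linarith

/-- The decrease is `k / (S (S + k))`, and `S + k ≤ (1 + β) S` because `S ≥ 1`. -/
lemma mean_mul_sq_le (ξ : ProbabilityMeasure (Icc (0 : ℝ) β)) {S : ℝ} (hS : 1 ≤ S) :
    mean ξ / (1 + β) * (S⁻¹) ^ 2
      ≤ S⁻¹ - ∫ k : Icc (0 : ℝ) β, (S + k)⁻¹ ∂(ξ : Measure (Icc (0 : ℝ) β)) := by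
  have hβ := bound_nonneg ξ
  have hS0 : 0 < S := by linarith
  have hi := integrable_inv_add ξ hS0
  have := integral_mono (f := fun k : Icc (0 : ℝ) β => (k : ℝ) * ((1 + β)⁻¹ * (S⁻¹) ^ 2))
    (g := fun k : Icc (0 : ℝ) β => S⁻¹ - (S + k : ℝ)⁻¹)
    ((integrable_coe ξ).mul_const _) ((integrable_const _).sub hi)
    fun k => by
      have hk := k.2.1
      have hk' := k.2.2
      have : 0 < S + k := by linarith
      have e : S⁻¹ - (S + k : ℝ)⁻¹ = k * (S * (S + k))⁻¹ := by
        field_simp; ring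
      change (k : ℝ) * ((1 + β)⁻¹ * (S⁻¹) ^ 2) ≤ S⁻¹ - (S + k : ℝ)⁻¹
      rw [e]
      refine mul_le_mul_of_nonneg_left ?_ hk
      rw [inv_pow, ← mul_inv]
      have hkS : (k : ℝ) ≤ β * S := hk'.trans (le_mul_of_one_le_right hβ hS)
      exact inv_anti₀ (by positivity) (by nlinarith [mul_le_mul_of_nonneg_left hkS hS0.le])
  rw [integral_sub (integrable_const _) hi, integral_mul_const] at this
  simp only [integral_const, probReal_univ, one_smul] at this
  unfold mean
  calc _ = _ := by ring
    _ ≤ _ := this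

variable (μ ν : ProbabilityMeasure (Icc (0 : ℝ) β))

lemma transition_inv_total (p : Quadrant) :
    transition μ ν (fun q => (total q)⁻¹) p
      = proportion p * ∫ k : Icc (0 : ℝ) β, (total p + k)⁻¹ ∂(μ : Measure (Icc (0 : ℝ) β))
        + (1 - proportion p)
          * ∫ k : Icc (0 : ℝ) β, (total p + k)⁻¹ ∂(ν : Measure (Icc (0 : ℝ) β)) := by
  simp only [transition, total_addX, total_addY]

/-- The drift of the proportion compares the two means of `k / (S + k)`; both agree to first order
with `mean / S`, so equal means leave only a second-order term. -/
lemma transition_proportion (p : Quadrant) :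
    transition μ ν (fun q => (proportion q : ℝ)) p
      = proportion p + proportion p * (1 - proportion p) *
        ((1 - total p * ∫ k : Icc (0 : ℝ) β, (total p + k)⁻¹ ∂(μ : Measure (Icc (0 : ℝ) β)))
        - (1 - total p * ∫ k : Icc (0 : ℝ) β, (total p + k)⁻¹ ∂(ν : Measure (Icc (0 : ℝ) β)))) := by
  have hi := fun ξ : ProbabilityMeasure (Icc (0 : ℝ) β) =>
    (integrable_inv_add ξ (total_pos p)).const_mul (total p)
  have hi' := fun ξ : ProbabilityMeasure (Icc (0 : ℝ) β) => (integrable_const (1 : ℝ)).sub (hi ξ)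
  simp only [Pi.sub_def] at hi'
  simp only [transition, proportion_addX, proportion_addY, total_addX, total_addY]
  rw [integral_add (integrable_const _) ((hi' μ).const_mul _),
    integral_sub (integrable_const _) ((hi' ν).const_mul _), integral_const_mul,
    integral_const_mul, integral_sub (integrable_const _) (hi μ),
    integral_sub (integrable_const _) (hi ν), integral_const_mul, integral_const_mul]
  simp only [integral_const, probReal_univ, one_smul]
  ring

variable {μ ν}

/-- With `σ = β` times the expected decrease of `1 / S` under each colour, the drift of `Z` is at
least `-z (1 - z) σμ`, while `-β / S` gains `z σμ + (1 - z) σν`. The sum is at least `z² σμ + (1 -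
z) σν ≥ 0`. -/
lemma le_transition_sub (h : mean μ = mean ν) (p : Quadrant) :
    (proportion p : ℝ) - β * (total p)⁻¹
      ≤ transition μ ν (fun q => (proportion q : ℝ) - β * (total q)⁻¹) p := by
  have hβ := bound_nonneg μ
  rw [transition_sub μ ν (bddAway_comp_proportion continuous_subtype_val)
    (bddAway_inv_total.const_mul β), transition_const_mul, transition_inv_total,
    transition_proportion]
  have hz := (proportion p).2.1
  have hz' := sub_nonneg.2 (proportion p).2.2
  have h1 := one_sub_integral_inv_add_le ν (total_pos p)
  have h2 := le_one_sub_integral_inv_add μ (total_pos p)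
  have h3 := integral_inv_add_le μ (total_pos p)
  have h4 := integral_inv_add_le ν (total_pos p)
  rw [h] at h2
  set z : ℝ := (proportion p : ℝ)
  set s := (total p)⁻¹
  set bμ := ∫ k : Icc (0 : ℝ) β, (total p + k)⁻¹ ∂(μ : Measure (Icc (0 : ℝ) β))
  set bν := ∫ k : Icc (0 : ℝ) β, (total p + k)⁻¹ ∂(ν : Measure (Icc (0 : ℝ) β))
  have h5 : -(β * (s - bμ)) ≤ (1 - total p * bμ) - (1 - total p * bν) := by linarith
  have h6 := mul_le_mul_of_nonneg_left h5 (mul_nonneg hz hz')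
  have h7 : 0 ≤ z * z * (β * (s - bμ)) := mul_nonneg (mul_nonneg hz hz)
    (mul_nonneg hβ (by linarith))
  have h8 : 0 ≤ (1 - z) * (β * (s - bν)) := mul_nonneg hz' (mul_nonneg hβ (by linarith))
  nlinarith

/-- In the expected increment of `(Z - c)^2`, the cross term is at most twice `z σμ + (1 - z) σν`,
where `σμ, σν` are the expected decreases of `β / S` under each colour. The quadratic term is at
most once that quantity, because `(k / (S + k))² ≤ β (1 / S - 1 / (S + k))`. This accounts for the
constant `3`. -/
lemma transition_sq_add_le (h : mean μ = mean ν) (c : I) (p : Quadrant) :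
    transition μ ν (fun q => ((proportion q : ℝ) - c) ^ 2 + 3 * β * (total q)⁻¹) p
      ≤ ((proportion p : ℝ) - c) ^ 2 + 3 * β * (total p)⁻¹ := by
  have hβ := bound_nonneg μ
  have hsq : BddAway fun q => ((proportion q : ℝ) - c) ^ 2 :=
    bddAway_comp_proportion (f := fun t : I => ((t : ℝ) - c) ^ 2) (by fun_prop)
  rw [transition_add μ ν hsq (bddAway_inv_total.const_mul (3 * β)), transition_const_mul,
    transition_inv_total]
  have hi := fun ξ : ProbabilityMeasure (Icc (0 : ℝ) β) => integrable_inv_add ξ (total_pos p)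
  have hSp := total_pos p
  have hS := hSp.ne'
  have hr : ∀ k : Icc (0 : ℝ) β, (1 - total p * (total p + k : ℝ)⁻¹) ^ 2
      ≤ β * ((total p)⁻¹ - (total p + k : ℝ)⁻¹) := by
    intro k
    have hk := k.2.1
    have hk' : 0 ≤ β - k := sub_nonneg.2 k.2.2
    have hSk : 0 < total p + k := by linarith
    have e : β * ((total p)⁻¹ - (total p + k : ℝ)⁻¹) - (1 - total p * (total p + k : ℝ)⁻¹) ^ 2
        = k * ((β - k) * total p + k * β) / (total p * (total p + k) ^ 2) := by
      field_simp; ring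
    have : 0 ≤ (k : ℝ) * ((β - k) * total p + k * β) / (total p * (total p + k) ^ 2) := by
      positivity
    linarith
  have key : ∀ (ξ : ProbabilityMeasure (Icc (0 : ℝ) β)) (d a : ℝ) (f : Icc (0 : ℝ) β → ℝ),
      Integrable f (ξ : Measure (Icc (0 : ℝ) β)) →
      (∀ k, f k = (d + a * (1 - total p * (total p + k : ℝ)⁻¹)) ^ 2) →
      ∫ k, f k ∂(ξ : Measure (Icc (0 : ℝ) β)) ≤
        d ^ 2 + 2 * d * a * (1 - total p * ∫ k : Icc (0 : ℝ) β, (total p + k)⁻¹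
          ∂(ξ : Measure (Icc (0 : ℝ) β)))
        + a ^ 2 * (β * ((total p)⁻¹ - ∫ k : Icc (0 : ℝ) β, (total p + k)⁻¹
          ∂(ξ : Measure (Icc (0 : ℝ) β)))) := by
    intro ξ d a f hf hfe
    have := integral_mono
      (g := fun k : Icc (0 : ℝ) β => (d ^ 2 + 2 * d * a + a ^ 2 * β * (total p)⁻¹)
        - (2 * d * a * total p + a ^ 2 * β) * (total p + k : ℝ)⁻¹) hf
      ((integrable_const _).sub ((hi ξ).const_mul _)) fun k => by
        change f k ≤ (d ^ 2 + 2 * d * a + a ^ 2 * β * (total p)⁻¹)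
          - (2 * d * a * total p + a ^ 2 * β) * (total p + k : ℝ)⁻¹
        rw [hfe]
        nlinarith [mul_le_mul_of_nonneg_left (hr k) (sq_nonneg a)]
    rw [integral_sub (integrable_const _) ((hi ξ).const_mul _), integral_const_mul] at this
    simp only [integral_const, probReal_univ, one_smul] at this
    linarith
  have kX := key μ ((proportion p : ℝ) - c) (1 - proportion p) _ (hsq.integrable_addX μ p)
    fun k => by rw [proportion_addX, total_addX]; ring
  have kY := key ν ((proportion p : ℝ) - c) (-proportion p) _ (hsq.integrable_addY ν p)
    fun k => by rw [proportion_addY, total_addY]; ring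
  have hz := (proportion p).2.1
  have hz1 := (proportion p).2.2
  have hz' := sub_nonneg.2 hz1
  have hc := c.2.1
  have hc' := c.2.2
  have kX' := mul_le_mul_of_nonneg_left kX hz
  have kY' := mul_le_mul_of_nonneg_left kY hz'
  have h1 := one_sub_integral_inv_add_le ν hSp
  have h2 := le_one_sub_integral_inv_add μ hSp
  have h1' := one_sub_integral_inv_add_le μ hSp
  have h2' := le_one_sub_integral_inv_add ν hSp
  have h3 := integral_inv_add_le μ hSp
  have h4 := integral_inv_add_le ν hSp
  rw [h] at h2 h1'
  unfold transition
  set z : ℝ := (proportion p : ℝ)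
  set s := (total p)⁻¹
  set bμ := ∫ k : Icc (0 : ℝ) β, (total p + k)⁻¹ ∂(μ : Measure (Icc (0 : ℝ) β))
  set bν := ∫ k : Icc (0 : ℝ) β, (total p + k)⁻¹ ∂(ν : Measure (Icc (0 : ℝ) β))
  set aμ := 1 - total p * bμ
  set aν := 1 - total p * bν
  set σμ := β * (s - bμ)
  set σν := β * (s - bν)
  have hσμ : 0 ≤ σμ := mul_nonneg hβ (by linarith)
  have hσν : 0 ≤ σν := mul_nonneg hβ (by linarith)
  have hσ : 3 * β * (z * bμ + (1 - z) * bν) = 3 * β * s - 3 * (z * σμ + (1 - z) * σν) := by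
    simp only [σμ, σν]; ring
  rw [hσ]
  -- Uses `|z - c| ≤ 1` and the two-sided bound `|aμ - aν| ≤ σμ + σν`; the slack is `z² σμ + (1 -
  -- z)² σν`.
  have hdrift : (z - c) * (z * (1 - z) * (aμ - aν)) ≤ z * σμ + (1 - z) * σν := by
    have hd : |z - (c : ℝ)| ≤ 1 := abs_le.2 ⟨by linarith, by linarith⟩
    have hab : |aμ - aν| ≤ σμ + σν := abs_le.2 ⟨by linarith, by linarith⟩
    calc (z - c) * (z * (1 - z) * (aμ - aν)) ≤ |(z - c) * (z * (1 - z) * (aμ - aν))| :=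
          le_abs_self _
      _ = |z - (c : ℝ)| * (z * (1 - z) * |aμ - aν|) := by
          rw [abs_mul, abs_mul, abs_of_nonneg (mul_nonneg hz hz')]
      _ ≤ 1 * (z * (1 - z) * (σμ + σν)) := by gcongr
      _ ≤ z * σμ + (1 - z) * σν := by
          nlinarith [mul_nonneg (mul_nonneg hz hz) hσμ, mul_nonneg (mul_nonneg hz' hz') hσν]
  have hq1 : z * ((1 - z) ^ 2 * σμ) ≤ z * σμ := by
    refine mul_le_mul_of_nonneg_left (mul_le_of_le_one_left hσμ ?_) hz
    nlinarith
  have hq2 : (1 - z) * ((-z) ^ 2 * σν) ≤ (1 - z) * σν := by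
    refine mul_le_mul_of_nonneg_left (mul_le_of_le_one_left hσν ?_) hz'
    nlinarith
  linarith

end Drift

/-! ### Almost sure convergence and the law of the limit -/

lemma IsDriving.measurable_ZLim {Ω : Type*} [MeasurableSpace Ω] {P : Measure Ω}
    {U V W : ℕ → Ω → I} {β : ℝ} {μ ν : ProbabilityMeasure (Icc (0 : ℝ) β)} (h : IsDriving P U V W) (p : Quadrant) :
    Measurable (ZLim μ ν U V W p) :=
  RRU.measurable_ZLim μ ν h.measurable_U h.measurable_V h.measurable_W p

section Limit

variable {Ω : Type*} [MeasurableSpace Ω] {P : Measure Ω} [IsProbabilityMeasure P]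
  {U V W : ℕ → Ω → I} {β : ℝ} {μ ν : ProbabilityMeasure (Icc (0 : ℝ) β)}

lemma IsDriving.submartingale (h : IsDriving P U V W) (hm : mean μ = mean ν) (p : Quadrant) :
    Submartingale (fun n ω => (proportion (urn μ ν U V W p n ω) : ℝ)
      - β * (total (urn μ ν U V W p n ω))⁻¹) (past h) P := by
  have hg : BddAway fun q => (proportion q : ℝ) - β * (total q)⁻¹ :=
    (bddAway_comp_proportion continuous_subtype_val).sub (bddAway_inv_total.const_mul β)
  refine submartingale_of_setIntegral_le_succ
    (fun n => (hg.measurable.comp (measurable_past_urn h μ ν p n)).stronglyMeasurable)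
    (fun n => h.integrable_urn μ ν hg p n) fun n A hA => ?_
  rw [h.setIntegral_urn_succ μ ν hg p n hA]
  exact setIntegral_mono (h.integrable_urn μ ν hg p n).integrableOn
    (h.integrable_urn μ ν (hg.transition μ ν) p n).integrableOn
    fun ω => le_transition_sub hm _

/-- The bounded submartingale `Z - β / S` converges almost surely, and `1 / S` converges along every
path by monotonicity; adding the two recovers `Z`. -/
lemma IsDriving.ae_tendsto_Z (h : IsDriving P U V W) (hm : mean μ = mean ν) (p : Quadrant) :
    ∀ᵐ ω ∂P, Tendsto (fun n => Z μ ν U V W p n ω) atTop (𝓝 (ZLim μ ν U V W p ω)) := by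
  have hg : BddAway fun q => (proportion q : ℝ) - β * (total q)⁻¹ :=
    (bddAway_comp_proportion continuous_subtype_val).sub (bddAway_inv_total.const_mul β)
  obtain ⟨M, hM⟩ := hg.bounded _ (total_pos p)
  have hbdd : ∀ n, eLpNorm (fun ω => (proportion (urn μ ν U V W p n ω) : ℝ)
      - β * (total (urn μ ν U V W p n ω))⁻¹) 1 P ≤ (M.toNNReal : ENNReal) := by
    intro n
    refine (eLpNorm_le_of_ae_bound (C := M)
      (ae_of_all _ fun ω => hM _ (total_le_urn μ ν p n ω))).trans ?_
    simp [ENNReal.ofReal]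
  filter_upwards [(h.submartingale hm p).exists_ae_tendsto_of_bdd hbdd] with ω ⟨c, hc⟩
  have hanti : Antitone fun n => (total (urn μ ν U V W p n ω))⁻¹ :=
    antitone_nat_of_succ_le fun n => inv_anti₀ (total_pos _) (by
      rw [urn_succ]; exact total_le_step μ ν _ _)
  have hlim := tendsto_atTop_ciInf hanti ⟨0, by
    rintro _ ⟨n, rfl⟩; exact (inv_pos.2 (total_pos _)).le⟩
  have hZ := hc.add (hlim.const_mul β)
  simp only [sub_add_cancel] at hZ
  have hmem := isClosed_Icc.mem_of_tendsto hZ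
    (Eventually.of_forall fun n => (proportion (urn μ ν U V W p n ω)).2)
  have hZ' : Tendsto (fun n => Z μ ν U V W p n ω) atTop (𝓝 (⟨_, hmem⟩ : I)) :=
    tendsto_subtype_rng.2 hZ
  rw [ZLim, hZ'.limsup_eq]
  exact hZ'

lemma IsDriving.tendsto_iterate_transition (h : IsDriving P U V W) (hm : mean μ = mean ν)
    {f : I → ℝ} (hf : Continuous f) (p : Quadrant) :
    Tendsto (fun n => (transition μ ν)^[n] (fun q => f (proportion q)) p) atTop
      (𝓝 (∫ t, f t ∂(P.map (ZLim μ ν U V W p)))) := by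
  obtain ⟨M, hM⟩ := isCompact_univ.exists_bound_of_continuousOn hf.continuousOn
  rw [integral_map (h.measurable_ZLim p).aemeasurable hf.aestronglyMeasurable]
  simp only [← h.integral_urn μ ν (bddAway_comp_proportion hf)]
  refine tendsto_integral_of_dominated_convergence (fun _ => M) (fun n => ?_) (integrable_const M)
    (fun n => ae_of_all _ fun ω => hM _ (mem_univ _)) ?_
  · exact (hf.measurable.comp (measurable_proportion.comp
      (h.measurable_urn μ ν p n))).aestronglyMeasurable
  · filter_upwards [h.ae_tendsto_Z hm p] with ω hω
    exact (hf.tendsto _).comp hω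

lemma tendsto_integral_limitLaw (hm : mean μ = mean ν) {f : I → ℝ} (hf : Continuous f)
    (p : Quadrant) :
    Tendsto (fun n => (transition μ ν)^[n] (fun q => f (proportion q)) p) atTop
      (𝓝 (∫ t, f t ∂(limitLaw μ ν p : Measure I))) :=
  isDriving_sampleLaw.tendsto_iterate_transition hm hf p

/-- Integrals of continuous functions against either law are limits of the same iterates of `T`, and
they determine a finite measure. -/
lemma IsDriving.map_ZLim (h : IsDriving P U V W) (hm : mean μ = mean ν) (p : Quadrant) :
    P.map (ZLim μ ν U V W p) = limitLaw μ ν p := by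
  have := Measure.isProbabilityMeasure_map (μ := P)
    (h.measurable_ZLim (μ := μ) (ν := ν) p).aemeasurable
  exact ext_of_forall_integral_eq_of_IsFiniteMeasure fun f =>
    tendsto_nhds_unique (h.tendsto_iterate_transition hm f.continuous p)
      (tendsto_integral_limitLaw hm f.continuous p)

end Limit

/-! ### Distance to the initial proportion -/

section Distance

variable {β : ℝ} {μ ν : ProbabilityMeasure (Icc (0 : ℝ) β)}

/-- The compensated square centred at the initial proportion starts at `3 β / S` and its expectation
never increases; the nonnegative compensator is dropped before letting `n → ∞`. -/
lemma integral_sq_limitLaw_le (hm : mean μ = mean ν) (p : Quadrant) :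
    ∫ t : I, ((t : ℝ) - proportion p) ^ 2 ∂(limitLaw μ ν p : Measure I)
      ≤ 3 * β * (total p)⁻¹ := by
  have hβ := bound_nonneg μ
  have hD := isDriving_sampleLaw
  have hsq : BddAway fun q => ((proportion q : ℝ) - proportion p) ^ 2 :=
    bddAway_comp_proportion (f := fun t : I => ((t : ℝ) - proportion p) ^ 2) (by fun_prop)
  have hg := hsq.add (bddAway_inv_total.const_mul (3 * β))
  refine le_of_tendsto (tendsto_integral_limitLaw hm
    (f := fun t : I => ((t : ℝ) - proportion p) ^ 2) (by fun_prop) p)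
    (Eventually.of_forall fun n => ?_)
  rw [← hD.integral_urn μ ν hsq]
  have h1 := integral_mono (hD.integrable_urn μ ν hsq p n) (hD.integrable_urn μ ν hg p n)
    fun ω => le_add_of_nonneg_right (mul_nonneg (by linarith : 0 ≤ 3 * β)
      (inv_pos.2 (total_pos _)).le)
  refine h1.trans ?_
  clear h1
  induction n with
  | zero => simp [urn]
  | succ n ih =>
    rw [hD.integral_urn_succ μ ν hg]
    exact (integral_mono (hD.integrable_urn μ ν (hg.transition μ ν) p n)
      (hD.integrable_urn μ ν hg p n) fun ω => transition_sq_add_le hm _ _).trans ih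

lemma integral_abs_limitLaw_le (hm : mean μ = mean ν) (p : Quadrant) :
    ∫ t : I, |(t : ℝ) - proportion p| ∂(limitLaw μ ν p : Measure I)
      ≤ Real.sqrt (3 * β * (total p)⁻¹) := by
  refine Real.le_sqrt_of_sq_le (le_trans ?_ (integral_sq_limitLaw_le hm p))
  set a := ∫ t : I, |(t : ℝ) - proportion p| ∂(limitLaw μ ν p : Measure I) with ha
  have hi : Integrable (fun t : I => |(t : ℝ) - proportion p|) (limitLaw μ ν p : Measure I) :=
    (by fun_prop : Continuous fun t : I => |(t : ℝ) - proportion p|).integrable_of_hasCompactSupport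
      (HasCompactSupport.of_compactSpace _)
  have hi2 : Integrable (fun t : I => ((t : ℝ) - proportion p) ^ 2) (limitLaw μ ν p : Measure I) :=
    (by fun_prop : Continuous fun t : I => ((t : ℝ) - proportion p) ^ 2)
      |>.integrable_of_hasCompactSupport (HasCompactSupport.of_compactSpace _)
  -- Jensen's inequality, by integrating `(|t - z| - a)² ≥ 0` with `a` the first absolute moment.
  have := integral_mono ((hi.const_mul (2 * a)).sub (integrable_const (a ^ 2))) hi2 fun t => by
    change 2 * a * |(t : ℝ) - proportion p| - a ^ 2 ≤ ((t : ℝ) - proportion p) ^ 2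
    nlinarith [sq_nonneg (|(t : ℝ) - proportion p| - a), sq_abs ((t : ℝ) - proportion p)]
  simp only [Pi.sub_apply] at this
  rw [integral_sub (hi.const_mul _) (integrable_const _), integral_const_mul, ← ha] at this
  simp only [integral_const, probReal_univ, one_smul] at this
  linarith

/-- The distribution function of `ξ` is the `ξ`-average of those of point masses. The triangle
inequality and Fubini reduce the claim to two point masses. -/
lemma dW_pointMass_le_integral (ξ : ProbabilityMeasure I) (c : I) :
    dW ξ (pointMass c) ≤ ∫ t : I, |(t : ℝ) - c| ∂(ξ : Measure I) := by
  have hmeas : Measurable fun q : ℝ × I =>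
      |(if (q.2 : ℝ) ≤ q.1 then (1 : ℝ) else 0) - if (c : ℝ) ≤ q.1 then 1 else 0| := by
    refine Measurable.abs ((Measurable.ite (measurableSet_le (by fun_prop) (by fun_prop))
      measurable_const measurable_const).sub (Measurable.ite (measurableSet_le (by fun_prop)
      (by fun_prop)) measurable_const measurable_const))
  have hint : Integrable (fun q : ℝ × I =>
      |(if (q.2 : ℝ) ≤ q.1 then (1 : ℝ) else 0) - if (c : ℝ) ≤ q.1 then 1 else 0|)
      ((volume.restrict (Ioc (0 : ℝ) 1)).prod (ξ : Measure I)) := by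
    refine Integrable.of_bound hmeas.aestronglyMeasurable 1 (ae_of_all _ fun q => ?_)
    split_ifs <;> simp
  have hpt : ∀ r : ℝ, |distFun ξ r - distFun (pointMass c) r|
      ≤ ∫ t : I, |(if (t : ℝ) ≤ r then (1 : ℝ) else 0) - if (c : ℝ) ≤ r then 1 else 0|
        ∂(ξ : Measure I) := by
    intro r
    have hs : MeasurableSet {s : I | (s : ℝ) ≤ r} := measurableSet_le (by fun_prop) (by fun_prop)
    have hi : Integrable (fun t : I => if (t : ℝ) ≤ r then (1 : ℝ) else 0) (ξ : Measure I) :=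
      Integrable.of_bound (Measurable.ite hs measurable_const
        measurable_const).aestronglyMeasurable 1 (ae_of_all _ fun t => by split_ifs <;> simp)
    have e : distFun ξ r = ∫ t : I, (if (t : ℝ) ≤ r then (1 : ℝ) else 0) ∂(ξ : Measure I) := by
      rw [distFun, ← integral_indicator_one hs]
      rfl
    rw [distFun_pointMass, e]
    have := integral_sub hi (integrable_const (if (c : ℝ) ≤ r then (1 : ℝ) else 0))
    rw [integral_const, probReal_univ, one_smul] at this
    rw [← this]
    exact abs_integral_le_integral_abs
  have hle : ∀ t : I, ∫ r in Ioc (0 : ℝ) 1,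
      |(if (t : ℝ) ≤ r then (1 : ℝ) else 0) - if (c : ℝ) ≤ r then 1 else 0| ≤ |(t : ℝ) - c| := by
    intro t
    have := dW_pointMass_le t c
    rw [dW, intervalIntegral.integral_of_le zero_le_one] at this
    simpa only [distFun_pointMass] using this
  rw [dW, intervalIntegral.integral_of_le zero_le_one]
  calc _ ≤ ∫ r in Ioc (0 : ℝ) 1, ∫ t : I,
        |(if (t : ℝ) ≤ r then (1 : ℝ) else 0) - if (c : ℝ) ≤ r then 1 else 0| ∂(ξ : Measure I) :=
        integral_mono_of_nonneg (ae_of_all _ fun r => abs_nonneg _) hint.integral_prod_left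
          (ae_of_all _ hpt)
    _ = ∫ t : I, (∫ r in Ioc (0 : ℝ) 1,
        |(if (t : ℝ) ≤ r then (1 : ℝ) else 0) - if (c : ℝ) ≤ r then 1 else 0|) ∂(ξ : Measure I) :=
        integral_integral_swap hint
    _ ≤ _ := integral_mono hint.integral_prod_right
        ((by fun_prop : Continuous fun t : I => |(t : ℝ) - c|).integrable_of_hasCompactSupport
          (HasCompactSupport.of_compactSpace _)) hle

/-- The strict inequality comes from `3 < 4` under the square root, together with `β > 0`. -/
lemma dW_limitLaw_lt (hβ : 0 < β) (hm : mean μ = mean ν) (p : Quadrant) :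
    dW (limitLaw μ ν p) (pointMass (proportion p)) < 2 * Real.sqrt (β / total p) := by
  have hpos : 0 < β / total p := div_pos hβ (total_pos p)
  refine ((dW_pointMass_le_integral _ _).trans (integral_abs_limitLaw_le hm p)).trans_lt ?_
  have e : 2 * Real.sqrt (β / total p) = Real.sqrt (4 * (β / total p)) := by
    rw [Real.sqrt_mul (by norm_num), show (4 : ℝ) = 2 ^ 2 by norm_num,
      Real.sqrt_sq (by norm_num)]
  rw [e]
  refine Real.sqrt_lt_sqrt (by rw [mul_assoc, ← div_eq_mul_inv]; positivity) ?_
  rw [mul_assoc, ← div_eq_mul_inv]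
  linarith

end Distance

/-! ### The functional equation -/

section Equation

variable {β : ℝ} {μ ν : ProbabilityMeasure (Icc (0 : ℝ) β)}

lemma tendsto_transition {g : ℕ → Quadrant → ℝ} {g₀ : Quadrant → ℝ} {M : ℝ}
    (hg : ∀ n, Measurable (g n)) (hb : ∀ n q, |g n q| ≤ M)
    (hlim : ∀ q, Tendsto (fun n => g n q) atTop (𝓝 (g₀ q))) (p : Quadrant) :
    Tendsto (fun n => transition μ ν (g n) p) atTop (𝓝 (transition μ ν g₀ p)) := by
  refine (Tendsto.const_mul _ ?_).add (Tendsto.const_mul _ ?_)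
  · exact tendsto_integral_of_dominated_convergence (fun _ => M)
      (fun n => ((hg n).comp (measurable_addX p)).aestronglyMeasurable) (integrable_const M)
      (fun n => ae_of_all _ fun k => hb n _) (ae_of_all _ fun k => hlim _)
  · exact tendsto_integral_of_dominated_convergence (fun _ => M)
      (fun n => ((hg n).comp (measurable_addY p)).aestronglyMeasurable) (integrable_const M)
      (fun n => ae_of_all _ fun k => hb n _) (ae_of_all _ fun k => hlim _)

lemma abs_iterate_transition_le {g : Quadrant → ℝ} {M : ℝ} (h : ∀ q, |g q| ≤ M) (n : ℕ)
    (q : Quadrant) : |(transition μ ν)^[n] g q| ≤ M := by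
  induction n generalizing q with
  | zero => exact h q
  | succ n ih =>
    rw [Function.iterate_succ_apply']
    exact abs_transition_le μ ν fun q _ => ih q

lemma measurable_integral_limitLaw (hm : mean μ = mean ν) {f : I → ℝ} (hf : Continuous f) :
    Measurable fun q => ∫ t, f t ∂(limitLaw μ ν q : Measure I) :=
  measurable_of_tendsto_metrizable
    (fun n => ((bddAway_comp_proportion hf).iterate_transition μ ν n).measurable)
    (tendsto_pi_nhds.2 fun q => tendsto_integral_limitLaw hm hf q)

/-- Applying `T` to the limit of `T^n` gives the limit of `T^(n+1)`, by dominated convergence. -/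
lemma transition_integral_limitLaw (hm : mean μ = mean ν) {f : I → ℝ} (hf : Continuous f)
    (p : Quadrant) :
    transition μ ν (fun q => ∫ t, f t ∂(limitLaw μ ν q : Measure I)) p
      = ∫ t, f t ∂(limitLaw μ ν p : Measure I) := by
  obtain ⟨M, hM⟩ := isCompact_univ.exists_bound_of_continuousOn hf.continuousOn
  have h1 := tendsto_transition (μ := μ) (ν := ν)
    (fun n => ((bddAway_comp_proportion hf).iterate_transition μ ν n).measurable)
    (fun n q => abs_iterate_transition_le (fun q => hM (proportion q) (mem_univ _)) n q)
    (fun q => tendsto_integral_limitLaw hm hf q) p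
  refine tendsto_nhds_unique h1 ?_
  have h2 := (tendsto_integral_limitLaw hm hf p).comp (tendsto_add_atTop_nat 1)
  refine h2.congr fun n => ?_
  exact congrFun (Function.iterate_succ_apply' _ _ _) p

/-- Dynkin's π-λ argument from closed sets, whose indicators are limits of continuous functions. The
two claims are carried together because additivity of `T` requires integrability, hence
measurability. -/
lemma measurable_and_transition_limitLaw (hm : mean μ = mean ν) {B : Set I}
    (hB : MeasurableSet B) :
    (Measurable fun q => (limitLaw μ ν q : Measure I).real B) ∧
      ∀ p, transition μ ν (fun q => (limitLaw μ ν q : Measure I).real B) p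
        = (limitLaw μ ν p : Measure I).real B := by
  have hgen : (inferInstance : MeasurableSpace I) = MeasurableSpace.generateFrom {s | IsClosed s} := by
    rw [← borel_eq_generateFrom_isClosed]; exact BorelSpace.measurable_eq
  -- Both properties survive bounded pointwise limits; this serves closed sets and countable
  -- disjoint unions alike.
  have hlim : ∀ (g : ℕ → Quadrant → ℝ) (g₀ : Quadrant → ℝ), (∀ n, Measurable (g n)) →
      (∀ n q, |g n q| ≤ 1) → (∀ q, Tendsto (fun n => g n q) atTop (𝓝 (g₀ q))) →
      (∀ n p, transition μ ν (g n) p = g n p) →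
      Measurable g₀ ∧ ∀ p, transition μ ν g₀ p = g₀ p := by
    intro g g₀ h1 h2 h3 h4
    refine ⟨measurable_of_tendsto_metrizable h1 (tendsto_pi_nhds.2 h3), fun p => ?_⟩
    refine tendsto_nhds_unique (tendsto_transition h1 h2 h3 p) ?_
    simp only [h4]
    exact h3 p
  induction B, hB using MeasurableSpace.induction_on_inter hgen isPiSystem_isClosed with
  | empty => simp [transition_const]
  | basic F hF =>
    have hF' : IsClosed F := hF
    have hle : ∀ n t, ‖((hF'.apprSeq n t : NNReal) : ℝ)‖ ≤ 1 := fun n t => by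
      rw [Real.norm_eq_abs, NNReal.abs_eq]
      exact_mod_cast HasOuterApproxClosed.apprSeq_apply_le_one hF' n t
    have hc : ∀ n, Continuous fun t => ((hF'.apprSeq n t : NNReal) : ℝ) := fun n =>
      NNReal.continuous_coe.comp (hF'.apprSeq n).continuous
    refine hlim (fun n q => ∫ t, ((hF'.apprSeq n t : NNReal) : ℝ) ∂(limitLaw μ ν q : Measure I)) _
      (fun n => measurable_integral_limitLaw hm (hc n)) (fun n q => ?_) (fun q => ?_)
      fun n p => transition_integral_limitLaw hm (hc n) p
    · simpa using norm_integral_le_of_norm_le_const (μ := (limitLaw μ ν q : Measure I))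
        (ae_of_all _ fun t => hle n t)
    · rw [← integral_indicator_one hF'.measurableSet]
      refine tendsto_integral_of_dominated_convergence (fun _ => 1)
        (fun n => (hc n).aestronglyMeasurable) (integrable_const 1)
        (fun n => ae_of_all _ fun t => hle n t) (ae_of_all _ fun t => ?_)
      have := (tendsto_pi_nhds.1 (HasOuterApproxClosed.tendsto_apprSeq hF') t)
      have h2 := (NNReal.continuous_coe.tendsto _).comp this
      convert! h2 using 2
      by_cases ht : t ∈ F <;> simp [ht]
  | compl B hB ih =>
    simp only [probReal_compl_eq_one_sub hB]
    refine ⟨measurable_const.sub ih.1, fun p => ?_⟩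
    rw [transition_sub μ ν (.of_bound measurable_const fun _ => le_rfl)
      (.of_bound ih.1 (M := 1) fun q => by
        rw [abs_of_nonneg measureReal_nonneg]; exact measureReal_le_one), transition_const, ih.2]
  | iUnion B hd hB ih =>
    have hfin : ∀ (n : ℕ) (q : Quadrant), (limitLaw μ ν q : Measure I).real
        (⋃ i ∈ Finset.range n, B i)
        = ∑ i ∈ Finset.range n, (limitLaw μ ν q : Measure I).real (B i) := fun n q =>
      measureReal_biUnion_finset (fun i _ j _ hij => hd hij) fun i _ => hB i
    have hmeas : ∀ n, Measurable fun q =>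
        ∑ i ∈ Finset.range n, (limitLaw μ ν q : Measure I).real (B i) := fun n =>
      Finset.measurable_fun_sum _ fun i _ => (ih i).1
    have hbd : ∀ n q, |∑ i ∈ Finset.range n, (limitLaw μ ν q : Measure I).real (B i)| ≤ 1 := by
      intro n q
      rw [← hfin, abs_of_nonneg measureReal_nonneg]
      exact measureReal_le_one
    refine hlim (fun n q => ∑ i ∈ Finset.range n, (limitLaw μ ν q : Measure I).real (B i)) _
      hmeas hbd (fun q => ?_) fun n => ?_
    · have hne : ∑' i, (limitLaw μ ν q : Measure I) (B i) ≠ ⊤ := by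
        rw [← measure_iUnion hd hB]
        exact measure_ne_top _ _
      have := (ENNReal.hasSum_toReal hne).tendsto_sum_nat
      rwa [← ENNReal.tsum_toReal_eq fun i => measure_ne_top _ _, ← measure_iUnion hd hB] at this
    · induction n with
      | zero => simp [transition_const]
      | succ n ihn =>
        intro p
        simp only [Finset.sum_range_succ]
        rw [transition_add μ ν (.of_bound (hmeas n) (hbd n))
          (.of_bound (ih n).1 (M := 1) fun q => by
            rw [abs_of_nonneg measureReal_nonneg]; exact measureReal_le_one), ihn, (ih n).2]

/-- This is invariance under `T` multiplied by the total mass, since `x = S z` and `y = S (1 - z)`.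
-/
lemma limitLaw_equation (hm : mean μ = mean ν) (p : Quadrant) {B : Set I} (hB : MeasurableSet B) :
    p.1.1 * ∫ k, ((limitLaw μ ν p : Measure I).real B
        - (limitLaw μ ν (addX p k) : Measure I).real B) ∂(μ : Measure (Icc (0 : ℝ) β))
      + p.1.2 * ∫ k, ((limitLaw μ ν p : Measure I).real B
        - (limitLaw μ ν (addY p k) : Measure I).real B) ∂(ν : Measure (Icc (0 : ℝ) β)) = 0 := by
  obtain ⟨h1, h2⟩ := measurable_and_transition_limitLaw (μ := μ) (ν := ν) hm hB
  have hb : BddAway fun q => (limitLaw μ ν q : Measure I).real B :=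
    .of_bound h1 (M := 1) fun q => by
      rw [abs_of_nonneg measureReal_nonneg]; exact measureReal_le_one
  have h3 := h2 p
  have hS := total_pos p
  have ex : p.1.1 = total p * proportion p := by
    change p.1.1 = total p * (p.1.1 / total p)
    field_simp
  have ey : p.1.2 = total p * (1 - proportion p) := by
    rw [mul_sub, ← ex, total]; ring
  rw [integral_sub (integrable_const _) (hb.integrable_addX μ p),
    integral_sub (integrable_const _) (hb.integrable_addY ν p), ex, ey]
  simp only [integral_const, probReal_univ, one_smul]
  unfold transition at h3
  linear_combination (-total p) * h3

lemma limitLaw_eq_pointMass (hm : mean μ = mean ν) {p : Quadrant} {t : I}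
    (h : ∀ (f : I → ℝ) (n : ℕ), (transition μ ν)^[n] (fun q => f (proportion q)) p = f t) :
    limitLaw μ ν p = pointMass t := by
  suffices (limitLaw μ ν p : Measure I) = pointMass t from Subtype.ext this
  refine ext_of_forall_integral_eq_of_IsFiniteMeasure fun f => ?_
  refine (tendsto_nhds_unique (tendsto_integral_limitLaw hm f.continuous p) ?_).trans
    (integral_dirac f t).symm
  simp only [h f]
  exact tendsto_const_nhds

/-- On this axis the weight of `addX` is zero and `addY` stays on the axis, so the proportion
remains `0` under all iterates of `T`. -/
lemma limitLaw_left (hm : mean μ = mean ν) {p : Quadrant} (hp : p.1.1 = 0) :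
    limitLaw μ ν p = pointMass 0 := by
  refine limitLaw_eq_pointMass hm fun f n => ?_
  have hz : ∀ q : Quadrant, q.1.1 = 0 → proportion q = 0 := fun q hq =>
    Subtype.ext (by simp [proportion, hq])
  induction n generalizing p with
  | zero => exact congrArg f (hz p hp)
  | succ n ih =>
    rw [Function.iterate_succ_apply', transition, hz p hp]
    have : ∀ k : Icc (0 : ℝ) β,
        (transition μ ν)^[n] (fun q => f (proportion q)) (addY p k) = f 0 := fun k => ih hp
    simp [this]

lemma limitLaw_lower (hm : mean μ = mean ν) {p : Quadrant} (hp : p.1.2 = 0) :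
    limitLaw μ ν p = pointMass 1 := by
  refine limitLaw_eq_pointMass hm fun f n => ?_
  have hz : ∀ q : Quadrant, q.1.2 = 0 → proportion q = 1 := fun q hq => by
    have hS := q.sum_pos
    rw [hq, add_zero] at hS
    exact Subtype.ext (by simp [proportion, hq, hS.ne'])
  induction n generalizing p with
  | zero => exact congrArg f (hz p hp)
  | succ n ih =>
    rw [Function.iterate_succ_apply', transition, hz p hp]
    have : ∀ k : Icc (0 : ℝ) β,
        (transition μ ν)^[n] (fun q => f (proportion q)) (addX p k) = f 1 := fun k => ih hp
    simp [this]

end Equation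

/-! ### Continuity -/

section Continuity

variable {β : ℝ} {μ ν : ProbabilityMeasure (Icc (0 : ℝ) β)}

/-- The shift by `1` replaces `1 / S` with a function bounded on the whole quadrant, so that its
decay can be uniform in the starting point. -/
lemma bddAway_inv_one_add_total : BddAway fun q => (1 + total q)⁻¹ := by
  refine .of_bound (M := 1) (continuous_total.measurable.const_add 1).inv fun q => ?_
  have := total_pos q
  rw [abs_of_pos (by positivity)]
  exact inv_le_one_of_one_le₀ (by linarith)

lemma transition_inv_one_add_total_le (hm : mean μ = mean ν) (p : Quadrant) :
    transition μ ν (fun q => (1 + total q)⁻¹) p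
      ≤ (1 + total p)⁻¹ - mean μ / (1 + β) * ((1 + total p)⁻¹) ^ 2 := by
  have hS := total_pos p
  have h1 := mean_mul_sq_le μ (S := 1 + total p) (by linarith)
  have h2 := mean_mul_sq_le ν (S := 1 + total p) (by linarith)
  rw [← hm] at h2
  have h3 := mul_le_mul_of_nonneg_left h1 (proportion p).2.1
  have h4 := mul_le_mul_of_nonneg_left h2 (sub_nonneg.2 (proportion p).2.2)
  simp only [transition, total_addX, total_addY, ← add_assoc]
  linarith

/-- The numbers `a_n = E[1 / (1 + S_n)]` satisfy `a_{n+1} ≤ a_n - c a_n²` with `c = mean μ / (1 +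
β)` and `a_0 ≤ 1`. While `a_n > ε`, each step loses at least `c ε²`; once below `ε` the sequence
stays there. -/
lemma iterate_transition_inv_one_add_total (hm : mean μ = mean ν) {ε : ℝ} (hε : 0 < ε) (n : ℕ)
    (p : Quadrant) :
    (transition μ ν)^[n] (fun q => (1 + total q)⁻¹) p ≤ ε ∨
      (transition μ ν)^[n] (fun q => (1 + total q)⁻¹) p ≤ 1 - n * (mean μ / (1 + β) * ε ^ 2) := by
  have hβ := bound_nonneg μ
  have hD := isDriving_sampleLaw
  have hmean : 0 ≤ mean μ := integral_nonneg fun k => k.2.1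
  have hc : 0 ≤ mean μ / (1 + β) := by positivity
  have hr := bddAway_inv_one_add_total
  have hr2 : BddAway fun q => ((1 + total q)⁻¹) ^ 2 := by
    refine .of_bound (M := 1) (hr.measurable.pow_const 2) fun q => ?_
    have := total_pos q
    have h1 : (1 + total q)⁻¹ ≤ 1 := inv_le_one_of_one_le₀ (by linarith)
    rw [abs_of_nonneg (by positivity)]
    exact pow_le_one₀ (by positivity) h1
  have hstep : ∀ n, (transition μ ν)^[n + 1] (fun q => (1 + total q)⁻¹) p
      ≤ (transition μ ν)^[n] (fun q => (1 + total q)⁻¹) p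
        - mean μ / (1 + β) * ((transition μ ν)^[n] (fun q => (1 + total q)⁻¹) p) ^ 2 := by
    intro n
    simp only [← hD.integral_urn μ ν hr]
    rw [hD.integral_urn_succ μ ν hr]
    have hi := hD.integrable_urn μ ν hr p n
    have hi2 := hD.integrable_urn μ ν hr2 p n
    have h1 := integral_mono (hD.integrable_urn μ ν (hr.transition μ ν) p n)
      (hi.sub (hi2.const_mul (mean μ / (1 + β)))) fun ω => transition_inv_one_add_total_le hm _
    simp only [Pi.sub_apply] at h1
    rw [integral_sub hi (hi2.const_mul _), integral_const_mul] at h1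
    refine h1.trans (sub_le_sub_left (mul_le_mul_of_nonneg_left ?_ hc) _)
    set a := ∫ ω, (1 + total (urn μ ν (fun n ω => ω.1 n) (fun n ω => (ω.2 n).1)
      (fun n ω => (ω.2 n).2) p n ω))⁻¹ ∂(sampleLaw : Measure SampleSpace) with ha
    -- Jensen again: the square of the mean is at most the mean of the square.
    have h2 := integral_mono ((hi.const_mul (2 * a)).sub (integrable_const (a ^ 2))) hi2
      fun ω => by
        simp only [Pi.sub_apply]
        nlinarith [sq_nonneg ((1 + total (urn μ ν (fun n ω => ω.1 n) (fun n ω => (ω.2 n).1)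
          (fun n ω => (ω.2 n).2) p n ω))⁻¹ - a)]
    simp only [Pi.sub_apply] at h2
    rw [integral_sub (hi.const_mul _) (integrable_const _), integral_const_mul, ← ha] at h2
    simp only [integral_const, probReal_univ, one_smul] at h2
    linarith
  induction n with
  | zero =>
    right
    have := total_pos p
    simpa using inv_le_one_of_one_le₀ (by linarith : 1 ≤ 1 + total p)
  | succ n ih =>
    have h1 := hstep n
    set a := (transition μ ν)^[n] (fun q => (1 + total q)⁻¹) p
    by_cases ha : a ≤ ε
    · left
      have : 0 ≤ mean μ / (1 + β) * a ^ 2 := by positivity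
      linarith
    · right
      have h2 := ih.resolve_left ha
      have h3 : ε ^ 2 ≤ a ^ 2 := pow_le_pow_left₀ hε.le (not_le.1 ha).le 2
      have h4 := mul_le_mul_of_nonneg_left h3 hc
      push_cast
      linarith

lemma eventually_iterate_transition_le (hm : mean μ = mean ν) (hpos : 0 < mean μ) {ε : ℝ}
    (hε : 0 < ε) :
    ∀ᶠ n in atTop, ∀ p, (transition μ ν)^[n] (fun q => (1 + total q)⁻¹) p ≤ ε := by
  have hβ := bound_nonneg μ
  have hc : 0 < mean μ / (1 + β) * ε ^ 2 := by positivity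
  obtain ⟨N, hN⟩ := exists_nat_gt (1 / (mean μ / (1 + β) * ε ^ 2))
  filter_upwards [eventually_ge_atTop N] with n hn p
  refine (iterate_transition_inv_one_add_total hm hε n p).elim id fun h => ?_
  have h1 : 1 < (n : ℝ) * (mean μ / (1 + β) * ε ^ 2) := by
    rw [← div_lt_iff₀ hc]
    exact hN.trans_le (by exact_mod_cast hn)
  linarith

/-- The moment `Q` satisfies both `Q S ≤ 3 β` and `Q ≤ 1`; adding them covers large and small total
mass at once. -/
lemma integral_sq_limitLaw_le_inv_one_add (hm : mean μ = mean ν) (p : Quadrant) :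
    ∫ t : I, ((t : ℝ) - proportion p) ^ 2 ∂(limitLaw μ ν p : Measure I)
      ≤ (1 + 3 * β) * (1 + total p)⁻¹ := by
  have hβ := bound_nonneg μ
  have hS := total_pos p
  have h1 := integral_sq_limitLaw_le hm p
  have h2 : ∫ t : I, ((t : ℝ) - proportion p) ^ 2 ∂(limitLaw μ ν p : Measure I) ≤ 1 := by
    have := integral_mono_of_nonneg (μ := (limitLaw μ ν p : Measure I))
      (ae_of_all _ fun t : I => sq_nonneg ((t : ℝ) - proportion p)) (integrable_const (1 : ℝ))
      (ae_of_all _ fun t : I => by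
        have := t.2.1; have := t.2.2
        have := (proportion p).2.1; have := (proportion p).2.2
        exact (sq_le_one_iff_abs_le_one _).2 (abs_le.2 ⟨by linarith, by linarith⟩))
    simpa using this
  set Q := ∫ t : I, ((t : ℝ) - proportion p) ^ 2 ∂(limitLaw μ ν p : Measure I)
  rw [← div_eq_mul_inv, le_div_iff₀ (by positivity)] at h1 ⊢
  linarith

/-- The Lipschitz bound and `d ≤ ε + d² / ε` convert the second moment estimate into one that is
affine in `1 / (1 + S)`, so its expectation along the urn can be taken directly. -/
lemma abs_integral_limitLaw_sub_le (hm : mean μ = mean ν) {f : I → ℝ} {K : NNReal}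
    (hf : LipschitzWith K f) {ε : ℝ} (hε : 0 < ε) (p : Quadrant) :
    |f (proportion p) - ∫ t, f t ∂(limitLaw μ ν p : Measure I)|
      ≤ K * ε + K * (1 + 3 * β) / ε * (1 + total p)⁻¹ := by
  have hcomp : ∀ g : I → ℝ, Continuous g → Integrable g (limitLaw μ ν p : Measure I) :=
    fun g hg => hg.integrable_of_hasCompactSupport (HasCompactSupport.of_compactSpace _)
  have hf' := hf.continuous
  have hK : (0 : ℝ) ≤ K := K.2
  have h1 : f (proportion p) - ∫ t, f t ∂(limitLaw μ ν p : Measure I)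
      = ∫ t, (f (proportion p) - f t) ∂(limitLaw μ ν p : Measure I) := by
    rw [integral_sub (integrable_const _) (hcomp f hf')]
    simp
  rw [h1]
  refine abs_integral_le_integral_abs.trans ?_
  have h2 : ∫ t, |f (proportion p) - f t| ∂(limitLaw μ ν p : Measure I)
      ≤ ∫ t : I, (K * ε + K / ε * ((t : ℝ) - proportion p) ^ 2)
        ∂(limitLaw μ ν p : Measure I) := by
    refine integral_mono (hcomp _ (by fun_prop)) (hcomp _ (by fun_prop)) fun t => ?_
    have h3 := hf.dist_le_mul (proportion p) t
    rw [Real.dist_eq, Subtype.dist_eq, Real.dist_eq, abs_sub_comm (proportion p : ℝ)] at h3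
    refine h3.trans ?_
    have h4 : |(t : ℝ) - proportion p| ≤ ε + ((t : ℝ) - proportion p) ^ 2 / ε := by
      rw [← sq_abs ((t : ℝ) - proportion p)]
      set d := |(t : ℝ) - proportion p|
      have hd : 0 ≤ d := abs_nonneg _
      rw [← sub_nonneg, show ε + d ^ 2 / ε - d = (ε ^ 2 + d ^ 2 - d * ε) / ε by field_simp]
      refine div_nonneg ?_ hε.le
      nlinarith [sq_nonneg (d - ε)]
    calc _ ≤ K * (ε + ((t : ℝ) - proportion p) ^ 2 / ε) := mul_le_mul_of_nonneg_left h4 hK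
      _ = _ := by ring
  refine h2.trans ?_
  rw [integral_add (integrable_const _) ((hcomp _ (by fun_prop)).const_mul _),
    integral_const, probReal_univ, one_smul, integral_const_mul]
  have := mul_le_mul_of_nonneg_left (integral_sq_limitLaw_le_inv_one_add (μ := μ) (ν := ν) hm p)
    (div_nonneg hK hε.le)
  refine (add_le_add_right this _).trans_eq ?_
  ring

lemma iterate_transition_integral_limitLaw (hm : mean μ = mean ν) {f : I → ℝ} (hf : Continuous f)
    (n : ℕ) : (transition μ ν)^[n] (fun q => ∫ t, f t ∂(limitLaw μ ν q : Measure I))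
      = fun q => ∫ t, f t ∂(limitLaw μ ν q : Measure I) :=
  Function.iterate_fixed (funext fun p => transition_integral_limitLaw hm hf p) n

/-- Since `Λ f` is fixed by `T`, the error at time `n` is `E[(f ∘ proportion - Λ f)(X_n, Y_n)]`. It
is small uniformly because `E[1 / (1 + S_n)]` is. -/
lemma tendstoUniformly_iterate_transition (hm : mean μ = mean ν) (hpos : 0 < mean μ) {f : I → ℝ}
    {K : NNReal} (hf : LipschitzWith K f) :
    TendstoUniformly (fun n q => (transition μ ν)^[n] (fun q => f (proportion q)) q)
      (fun q => ∫ t, f t ∂(limitLaw μ ν q : Measure I)) atTop := by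
  have hβ := bound_nonneg μ
  have hD := isDriving_sampleLaw
  have hK : (0 : ℝ) ≤ K := K.2
  have hfb := bddAway_comp_proportion hf.continuous
  obtain ⟨M, hM⟩ := isCompact_univ.exists_bound_of_continuousOn hf.continuous.continuousOn
  have hLb : BddAway fun q => ∫ t, f t ∂(limitLaw μ ν q : Measure I) :=
    .of_bound (measurable_integral_limitLaw hm hf.continuous) (M := M) fun q => by
      simpa using norm_integral_le_of_norm_le_const (μ := (limitLaw μ ν q : Measure I))
        (ae_of_all _ fun t => hM t (mem_univ _))
  have hr := bddAway_inv_one_add_total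
  rw [Metric.tendstoUniformly_iff]
  intro δ hδ
  -- With the threshold `ε² / (1 + 3β)` for the decay, both error terms are at most `K ε`, and `2 K
  -- ε < δ`; the `+ 1` gives strictness and covers `K = 0`.
  set ε := δ / (2 * (K + 1)) with hε'
  have hε : 0 < ε := by positivity
  filter_upwards [eventually_iterate_transition_le hm hpos
    (by positivity : 0 < ε ^ 2 / (1 + 3 * β))] with n hn p
  have h1 : (transition μ ν)^[n] (fun q => f (proportion q)) p
      - ∫ t, f t ∂(limitLaw μ ν p : Measure I)
      = ∫ ω, (f (proportion (urn μ ν (fun n ω => ω.1 n) (fun n ω => (ω.2 n).1)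
          (fun n ω => (ω.2 n).2) p n ω))
        - ∫ t, f t ∂(limitLaw μ ν (urn μ ν (fun n ω => ω.1 n) (fun n ω => (ω.2 n).1)
          (fun n ω => (ω.2 n).2) p n ω) : Measure I)) ∂(sampleLaw : Measure SampleSpace) := by
    rw [integral_sub (hD.integrable_urn μ ν hfb p n) (hD.integrable_urn μ ν hLb p n),
      hD.integral_urn μ ν hfb, hD.integral_urn μ ν hLb,
      iterate_transition_integral_limitLaw hm hf.continuous]
  rw [dist_comm, Real.dist_eq, h1]
  have hi := hD.integrable_urn μ ν hr p n
  have h2 := integral_mono ((hD.integrable_urn μ ν (hfb.sub hLb) p n).abs)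
    ((integrable_const (K * ε)).add (hi.const_mul (K * (1 + 3 * β) / ε)))
    fun ω => abs_integral_limitLaw_sub_le hm hf hε _
  simp only [Pi.add_apply] at h2
  rw [integral_add (integrable_const _) (hi.const_mul _), integral_const, probReal_univ,
    one_smul, integral_const_mul, hD.integral_urn μ ν hr] at h2
  refine (abs_integral_le_integral_abs.trans h2).trans_lt ?_
  have h3 := mul_le_mul_of_nonneg_left (hn p) (by positivity : 0 ≤ K * (1 + 3 * β) / ε)
  have h4 : K * (1 + 3 * β) / ε * (ε ^ 2 / (1 + 3 * β)) = K * ε := by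
    field_simp
  have h5 : 2 * (K + 1) * ε = δ := by rw [hε']; field_simp
  nlinarith

/-- `T` preserves bounded continuous functions, so `Λ f` is a uniform limit of continuous functions;
Lipschitz test functions suffice for weak convergence. -/
lemma tendsto_limitLaw (hm : mean μ = mean ν) (hpos : 0 < mean μ) (p : Quadrant) :
    Tendsto (limitLaw μ ν) (𝓝 p) (𝓝 (limitLaw μ ν p)) := by
  rw [tendsto_iff_forall_lipschitz_integral_tendsto]
  rintro f - ⟨K, hf⟩
  obtain ⟨M, hM⟩ := isCompact_univ.exists_bound_of_continuousOn hf.continuous.continuousOn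
  have hc : ∀ n, Continuous ((transition μ ν)^[n] (fun q => f (proportion q))) := by
    intro n
    induction n with
    | zero => exact hf.continuous.comp continuous_proportion
    | succ n ih =>
      rw [Function.iterate_succ_apply']
      exact continuous_transition μ ν ih
        fun q => abs_iterate_transition_le (fun q => hM (proportion q) (mem_univ _)) n q
  exact ((tendstoUniformly_iterate_transition hm hpos hf).continuous
    (Frequently.of_forall hc)).tendsto p

/-- Weak convergence gives convergence of distribution functions off the atoms of the limit. These
are countable, hence Lebesgue null, and dominated convergence on `[0, β]` concludes. -/
lemma tendsto_dW {ι : Type*} {l : Filter ι} [l.IsCountablyGenerated]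
    {ξ : ι → ProbabilityMeasure (Icc (0 : ℝ) β)} {ξ₀ : ProbabilityMeasure (Icc (0 : ℝ) β)}
    (h : Tendsto ξ l (𝓝 ξ₀)) : Tendsto (fun i => dW (ξ i) ξ₀) l (𝓝 0) := by
  have hae : ∀ᵐ r : ℝ, Tendsto (fun i => distFun (ξ i) r) l (𝓝 (distFun ξ₀ r)) := by
    have hcount := Measure.countable_meas_level_set_pos (μ := (ξ₀ : Measure (Icc (0 : ℝ) β)))
      (g := fun t : Icc (0 : ℝ) β => (t : ℝ)) measurable_subtype_coe
    filter_upwards [hcount.ae_notMem volume] with r hr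
    have h0 : (ξ₀ : Measure (Icc (0 : ℝ) β)) {t | (t : ℝ) = r} = 0 := by
      simpa [pos_iff_ne_zero] using hr
    have hfr : (ξ₀ : Measure (Icc (0 : ℝ) β)) (frontier {t | (t : ℝ) ≤ r}) = 0 :=
      measure_mono_null (frontier_le_subset_eq continuous_subtype_val continuous_const) h0
    exact (ENNReal.tendsto_toReal (measure_ne_top _ _)).comp
      (ProbabilityMeasure.tendsto_measure_of_null_frontier_of_tendsto' h hfr)
  have := intervalIntegral.tendsto_integral_filter_of_dominated_convergence
    (μ := volume) (a := 0) (b := β) (l := l)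
    (F := fun i r => |distFun (ξ i) r - distFun ξ₀ r|) (f := fun _ => (0 : ℝ)) (fun _ => (1 : ℝ))
    (Eventually.of_forall fun i => (((distFun_mono (ξ i)).measurable.sub
      (distFun_mono ξ₀).measurable).abs).aestronglyMeasurable)
    (Eventually.of_forall fun i => ae_of_all _ fun r _ => by
      rw [Real.norm_eq_abs, abs_abs]
      exact abs_le.2 ⟨by linarith [distFun_nonneg (ξ i) r, distFun_le_one ξ₀ r],
        by linarith [distFun_nonneg ξ₀ r, distFun_le_one (ξ i) r]⟩)
    intervalIntegrable_const
    (hae.mono fun r hr _ => by simpa using (hr.sub_const (distFun ξ₀ r)).abs)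
  simpa [dW] using this

end Continuity

/-! ### Assembly of the solution properties -/

lemma isSolution_limitLaw {β : ℝ} {μ ν : ProbabilityMeasure (Icc (0 : ℝ) β)} (hβ : 0 < β)
    (hm : mean μ = mean ν) (hpos : 0 < mean μ) : IsSolution μ ν deltaDatum (limitLaw μ ν) where
  continuous p := tendsto_dW (tendsto_limitLaw hm hpos p)
  equation p _ hB := limitLaw_equation hm p hB
  left_boundary _ hp := limitLaw_left hm hp
  lower_boundary _ hp := limitLaw_lower hm hp
  at_infinity := by
    have h0 : Tendsto (fun S : ℝ => 2 * Real.sqrt (β / S)) atTop (𝓝 0) := by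
      have := ((Real.continuous_sqrt.tendsto 0).comp
        (tendsto_const_nhds.div_atTop tendsto_id : Tendsto (fun S : ℝ => β / S) atTop (𝓝 0)))
      simpa using this.const_mul 2
    exact squeeze_zero
      (fun p => intervalIntegral.integral_nonneg zero_le_one fun _ _ => abs_nonneg _)
      (fun p => (dW_limitLaw_lt hβ hm p).le) (h0.comp tendsto_comap)

end RRU

end

theorem mainTheorem4 {β m₀ : ℝ} (hm₀ : 0 < m₀) (hβ : m₀ ≤ β)
    (μ ν : MeasureTheory.ProbabilityMeasure (Set.Icc (0 : ℝ) β))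
    (hμν : (μ, ν) ∈ RRU.parameterSet β m₀) :
    -- the limit proportion exists almost surely and has the law `limitLaw μ ν p`,
    -- whatever the driving sequences
    (∀ {Ω : Type*} [MeasurableSpace Ω] (P : MeasureTheory.Measure Ω)
        [MeasureTheory.IsProbabilityMeasure P] (U V W : ℕ → Ω → unitInterval),
        RRU.IsDriving P U V W → ∀ p : RRU.Quadrant,
          (∀ᵐ ω ∂P, Filter.Tendsto (fun n => RRU.Z μ ν U V W p n ω) Filter.atTop
            (nhds (RRU.ZLim μ ν U V W p ω))) ∧
          P.map (RRU.ZLim μ ν U V W p) = RRU.limitLaw μ ν p) ∧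
    -- the law of the limit proportion solves the problem with boundary datum `δ`
    RRU.IsSolution μ ν RRU.deltaDatum (RRU.limitLaw μ ν) ∧
    -- distance to the boundary datum
    (∀ p : RRU.Quadrant,
      RRU.dW (RRU.limitLaw μ ν p) (RRU.pointMass (RRU.proportion p))
        < 2 * Real.sqrt (β / (p.1.1 + p.1.2))) := by
  have hm : RRU.mean μ = RRU.mean ν := hμν.1
  have hpos : 0 < RRU.mean μ := hm₀.trans_le hμν.2
  have hβ' : 0 < β := hm₀.trans_le hβ
  exact ⟨fun P _ U V W h p => ⟨h.ae_tendsto_Z hm p, h.map_ZLim hm p⟩,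
    RRU.isSolution_limitLaw hβ' hm hpos, fun p => RRU.dW_limitLaw_lt hβ' hm p⟩
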